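/- Let $N\ge 1$, $m\ge 2$, and let $T_1,\dots,T_m:\mathbb R^N\to\mathbb R^N$ be non-singular linear maps with $\|T_i\|<1$ for the Euclidean operator norm. For a linear map $T$ with singular values $\alpha_1\ge\dots\ge\alpha_N$ let $\phi^s(T)=\alpha_1\cdots\alpha_{n-1}\alpha_n^{s-n+1}$ for $0\le s\le N$, where $n$ is the integer with $n-1<s\le n$ (so $\phi^0(T)=1$), and $\phi^s(T)=(\alpha_1\cdots\alpha_N)^{s/N}$ for $s\ge N$. For a finite word $\mathbf i=(i_1,\dots,i_k)$ over $\{1,\dots,m\}$ write $T_{\mathbf i}=T_{i_1}\cdots T_{i_k}$ and let $C_{\mathbf i}\subset I_\infty=\{1,\dots,m\}^{\mathbb N}$ be the cylinder of infinite sequences beginning with $\mathbf i$. Let $p_1,\dots,p_m>0$ with $\sum_i p_i=1$, and let $\mu$ be the Bernoulli probability measure on $I_\infty$ with $\mu(C_{\mathbf i})=p_{i_1}\cdots p_{i_k}$ for every finite word $\mathbf i$. Then there is a unique $d_1\ge 0$ for which the limit $$P(d_1,1)=\lim_{k\to\infty}\frac1k\sum_{|\mathbf i|=k}\mu(C_{\mathbf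 i})\log\bigl(\phi^{d_1}(T_{\mathbf i})^{-1}\mu(C_{\mathbf i})\bigr)$$ exists and equals $0$; moreover $d_1>0$, and the following holds. Let $\omega=(\omega_{\mathbf i})$ be any family of vectors of $\mathbb R^N$ indexed by the finite words for which there is a non-empty compact set $B\subset\mathbb R^N$ with $T_{i_k}(B)+\omega_{i_1,\dots,i_k}\subseteq B$ for all $k\ge 1$ and all words $(i_1,\dots,i_k)$. For $\mathbf i=(i_1,i_2,\dots)\in I_\infty$ put $$x^\omega(\mathbf i)=\omega_{i_1}+T_{i_1}\omega_{i_1,i_2}+T_{i_1}T_{i_2}\omega_{i_1,i_2,i_3}+\cdots,$$ and let $\mu^\omega(A)=\mu\{\mathbf i:x^\omega(\mathbf i)\in A\}$ for Borel sets $A\subseteq\mathbb R^N$. Then $$\limsup_{r\to0}\frac{\log\mu^\omega(B(x,r))}{\log r}\le\min\{d_1,N\}\qquad\text{for }\mu^\omega\text{-almost all }x\in\mathbb R^N,$$ where $B(x,r)$ is the closed ball with centre $x$ and radius $r$. -/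

import Mathlib

open MeasureTheory Filter Topology

noncomputable section

namespace AlmostSelfAffine

/-- The singular value function `φ^s(L)` of a linear map `L` on `ℝ^N`, where
`α₁ ≥ α₂ ≥ ⋯ ≥ α_N` are the singular values of `L` (Mathlib indexes them from `0`, so that
`α_{i+1}` is `singularValues i`). For `0 ≤ s < N` and `j = ⌊s⌋` it is
`α₁ ⋯ α_j α_{j+1}^{s-j}`; for integral `s = j` the last factor is `1`, so this agrees with
`α₁ ⋯ α_{n-1} α_n^{s-n+1}` for `n - 1 < s ≤ n`. For `s ≥ N` it is `(α₁ ⋯ α_N)^{s/N}`. -/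
def singularValueFunction {N : ℕ} (s : ℝ)
    (L : EuclideanSpace ℝ (Fin N) →L[ℝ] EuclideanSpace ℝ (Fin N)) : ℝ :=
  if s < N then
    (∏ i ∈ Finset.range ⌊s⌋₊, L.toLinearMap.singularValues i) *
      (L.toLinearMap.singularValues ⌊s⌋₊) ^ (s - (⌊s⌋₊ : ℝ))
  else
    (∏ i ∈ Finset.range N, L.toLinearMap.singularValues i) ^ (s / (N : ℝ))

/-- The curtailment `i|k = (i₁, …, i_k)` of an infinite sequence, as a finite word. -/
def curtail {m : ℕ} (i : ℕ → Fin m) (k : ℕ) : List (Fin m) :=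
  List.ofFn fun l : Fin k => i l

/-- The cylinder `C_u` of the infinite sequences that begin with the word `u = (u₁, …, u_k)`. -/
def wordCylinder {m k : ℕ} (u : Fin k → Fin m) : Set (ℕ → Fin m) :=
  {i | ∀ l : Fin k, i l = u l}

/-- The composition `T_u = T_{u₁} T_{u₂} ⋯ T_{u_k}` along a finite word. -/
def wordMap {N m : ℕ} (T : Fin m → EuclideanSpace ℝ (Fin N) →L[ℝ] EuclideanSpace ℝ (Fin N))
    (u : List (Fin m)) : EuclideanSpace ℝ (Fin N) →L[ℝ] EuclideanSpace ℝ (Fin N) :=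
  (u.map T).prod

/-- The Bernoulli measure on the code space with probabilities `p₁, …, p_m`. -/
def bernoulliMeasure {m : ℕ} (p : PMF (Fin m)) : Measure (ℕ → Fin m) :=
  Measure.infinitePi fun _ : ℕ => p.toMeasure

instance {m : ℕ} (p : PMF (Fin m)) : IsProbabilityMeasure (bernoulliMeasure p) := by
  unfold bernoulliMeasure
  infer_instance

/-- The Bernoulli measure of a cylinder is `p_{u₁} p_{u₂} ⋯ p_{u_k}`. -/
theorem bernoulliMeasure_wordCylinder {m k : ℕ} (p : PMF (Fin m)) (u : Fin k → Fin m) :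
    bernoulliMeasure p (wordCylinder u) = ∏ l : Fin k, p (u l) := by
  classical
  have hset : wordCylinder u =
      (Set.pi (Finset.range k : Set ℕ)
        fun n => if h : n < k then {u ⟨n, h⟩} else Set.univ) := by
    ext i
    simp only [wordCylinder, Set.mem_ofPred_eq, Set.mem_pi, Finset.coe_range, Set.mem_Iio]
    constructor
    · intro h n hn
      simp [hn, h ⟨n, hn⟩]
    · intro h l
      simpa using h l l.2
  rw [hset, bernoulliMeasure, Measure.infinitePi_pi]
  · rw [Finset.prod_range]
    refine Finset.prod_congr rfl fun l _ => ?_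
    simp
  · intro n _
    exact MeasurableSet.of_discrete

/-- The level-`k` expression
`(1/k) ∑_{|u| = k} μ(C_u) log (φ^s(T_u)⁻¹ μ(C_u))` whose limit is the pressure `P(s, 1)`. -/
def pressureOneTerm {N m : ℕ}
    (T : Fin m → EuclideanSpace ℝ (Fin N) →L[ℝ] EuclideanSpace ℝ (Fin N))
    (μ : Measure (ℕ → Fin m)) (s : ℝ) (k : ℕ) : ℝ :=
  (1 / (k : ℝ)) * ∑ u : Fin k → Fin m, μ.real (wordCylinder u) *
    Real.log ((singularValueFunction s (wordMap T (List.ofFn u)))⁻¹ * μ.real (wordCylinder u))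

/-- `P(s, 1) = P`: the limit defining the pressure at `q = 1` exists and equals `P`. -/
def HasPressureOne {N m : ℕ}
    (T : Fin m → EuclideanSpace ℝ (Fin N) →L[ℝ] EuclideanSpace ℝ (Fin N))
    (μ : Measure (ℕ → Fin m)) (s P : ℝ) : Prop :=
  Tendsto (fun k => pressureOneTerm T μ s k) atTop (𝓝 P)

/-- The translations `w` are compatible with the set `B`:
`T_{i_k}(B) + w_{i₁…i_k} ⊆ B` for every nonempty finite word `i₁…i_k = u a`
with last letter `a = i_k`. -/
def MapsIntoItself {N m : ℕ}
    (T : Fin m → EuclideanSpace ℝ (Fin N) →L[ℝ] EuclideanSpace ℝ (Fin N))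
    (w : List (Fin m) → EuclideanSpace ℝ (Fin N)) (B : Set (EuclideanSpace ℝ (Fin N))) : Prop :=
  ∀ (u : List (Fin m)) (a : Fin m), ∀ y ∈ B, T a y + w (u ++ [a]) ∈ B

/-- The point `x^w(i) = w_{i₁} + T_{i₁} w_{i₁i₂} + T_{i₁}T_{i₂} w_{i₁i₂i₃} + ⋯`. -/
def codingMap {N m : ℕ}
    (T : Fin m → EuclideanSpace ℝ (Fin N) →L[ℝ] EuclideanSpace ℝ (Fin N))
    (w : List (Fin m) → EuclideanSpace ℝ (Fin N)) (i : ℕ → Fin m) : EuclideanSpace ℝ (Fin N) :=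
  ∑' k : ℕ, wordMap T (curtail i k) (w (curtail i (k + 1)))

/-- The projected measure `μ^w(A) = μ {i : x^w(i) ∈ A}`. -/
def projectedMeasure {N m : ℕ}
    (T : Fin m → EuclideanSpace ℝ (Fin N) →L[ℝ] EuclideanSpace ℝ (Fin N))
    (w : List (Fin m) → EuclideanSpace ℝ (Fin N)) (μ : Measure (ℕ → Fin m)) :
    Measure (EuclideanSpace ℝ (Fin N)) :=
  μ.map (codingMap T w)

/-- The upper local dimension `limsup_{r → 0} log ν(B(x,r)) / log r`, with closed balls, as an
extended real (`log 0 = -∞`). -/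
def upperLocalDim {N : ℕ} (ν : Measure (EuclideanSpace ℝ (Fin N)))
    (x : EuclideanSpace ℝ (Fin N)) : EReal :=
  limsup (fun r : ℝ => ENNReal.log (ν (Metric.closedBall x r)) / ((Real.log r : ℝ) : EReal))
    (𝓝[>] (0 : ℝ))

/-- For linear contractions, the coding series converges absolutely and uniformly and the coding
map is continuous; so the projected measure is a genuine push-forward. -/
theorem summable_and_continuous_codingMap {N m : ℕ}
    {T : Fin m → EuclideanSpace ℝ (Fin N) →L[ℝ] EuclideanSpace ℝ (Fin N)}
    (hT : ∀ a, ‖T a‖ < 1) {w : List (Fin m) → EuclideanSpace ℝ (Fin N)}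
    {B : Set (EuclideanSpace ℝ (Fin N))} (hne : B.Nonempty) (hB : IsCompact B)
    (hw : MapsIntoItself T w B) :
    (∀ i : ℕ → Fin m, Summable fun k : ℕ => wordMap T (curtail i k) (w (curtail i (k + 1)))) ∧
      Continuous (codingMap T w) := by
  obtain ⟨R, hR⟩ := hB.isBounded.exists_norm_le
  obtain ⟨b, hb⟩ := hne
  obtain ⟨c, hc0, hc1, hc⟩ : ∃ c : ℝ, 0 ≤ c ∧ c < 1 ∧ ∀ a, ‖T a‖ ≤ c := by
    rcases isEmpty_or_nonempty (Fin m) with h | h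
    · exact ⟨0, le_rfl, one_pos, fun a => h.elim a⟩
    · obtain ⟨a₀, ha₀⟩ := Finite.exists_max fun a => ‖T a‖
      exact ⟨‖T a₀‖, norm_nonneg _, hT a₀, ha₀⟩
  have hwb : ∀ u a, ‖w (u ++ [a])‖ ≤ R + R := by
    intro u a
    have h1 := hR _ (hw u a b hb)
    have h2 : ‖T a b‖ ≤ R :=
      ((T a).le_of_opNorm_le (hT a).le b).trans (by simpa using hR b hb)
    calc ‖w (u ++ [a])‖ = ‖(T a b + w (u ++ [a])) - T a b‖ := by simp
      _ ≤ _ := (norm_sub_le _ _).trans (add_le_add h1 h2)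
  have hprod : ∀ u : List (Fin m), ‖wordMap T u‖ ≤ c ^ u.length := by
    intro u
    induction u with
    | nil =>
      simp only [wordMap, List.map_nil, List.prod_nil, List.length_nil, pow_zero]
      exact ContinuousLinearMap.norm_id_le
    | cons a u ih =>
      have : wordMap T (a :: u) = T a * wordMap T u := by simp [wordMap]
      rw [this, List.length_cons, pow_succ']
      exact (norm_mul_le _ _).trans (mul_le_mul (hc a) ih (norm_nonneg _) hc0)
  have hterm : ∀ (k : ℕ) (i : ℕ → Fin m),
      ‖wordMap T (curtail i k) (w (curtail i (k + 1)))‖ ≤ c ^ k * (R + R) := by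
    intro k i
    have hs : curtail i (k + 1) = curtail i k ++ [i k] := by
      unfold curtail
      rw [List.ofFn_succ_last]
      simp
    rw [hs]
    refine ((wordMap T (curtail i k)).le_opNorm _).trans ?_
    refine mul_le_mul ?_ (hwb _ _) (norm_nonneg _) (pow_nonneg hc0 k)
    simpa [curtail] using hprod (curtail i k)
  have hsum : Summable fun k : ℕ => c ^ k * (R + R) :=
    (summable_geometric_of_lt_one hc0 hc1).mul_right _
  refine ⟨fun i => Summable.of_norm_bounded hsum fun k => hterm k i, ?_⟩
  refine continuous_tsum (fun k => ?_) hsum hterm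
  have hfac : (fun i : ℕ → Fin m => wordMap T (curtail i k) (w (curtail i (k + 1)))) =
      (fun v : Fin (k + 1) → Fin m => wordMap T (List.ofFn fun l : Fin k => v l.castSucc)
        (w (List.ofFn v))) ∘ fun i l => i l := by
    ext i
    simp [curtail]
  rw [hfac]
  exact continuous_of_discreteTopology.comp (by fun_prop)

end AlmostSelfAffine

end

/-! Call `log (φ^s(T_u) / μ(C_u))` the cost of the word `u`. The pressure at `q = 1` is minus the
limit of the expected cost of `k` letters, divided by `k`. By Horn's inequality `φ^s` is
submultiplicative, so cost is subadditive under concatenation, and Fekete's lemma gives the limit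
`P(s)`. All the `T_a` expand lengths by factors between some `c > 0` and some `C < 1`, so `P` grows
in `s` at a rate between `-log C` and `-log c`; since `P(0) < 0`, it has exactly one zero `d` on
`[0, ∞)`, and `d > 0`.

Only an upper bound for the cost along typical sequences is needed, so the subadditive ergodic
theorem can be avoided: cutting a sequence into blocks of fixed length and applying the strong law
shows that the cost of `i|k` is eventually at most `εk`, almost surely.

Suppose `d < N`, put `j = ⌊d⌋`, and let `r` be the singular value `α_{j+1}` of `T_u`. The image of
`C_u` lies in a translate of `T_u` of a fixed ball, so `C_u` splits into at most `M ≈ α₁⋯α_j / r^j`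
classes whose images have diameter `O(r)`. The weight `μ(C_u)/M` per class equals, up to a constant,
`r^d` times the exponential of minus the cost. By Borel–Cantelli almost every point eventually lies
in classes of mass at least `(k+1)⁻²` times the weight, whence `μ^ω(B(x, A r)) ≥ r^{d+ε}`.
Consecutive values of `r` have ratio at least `c`, so these radii suffice. The translations enter
only through a uniform bound on the tails. If `d ≥ N`, the same counting with a cubic grid gives the
bound `N`. -/

noncomputable section

/-! ### Spans of parts of an orthonormal basis -/

section OrthonormalBasis

open Module

variable {E : Type*} [NormedAddCommGroup E] [InnerProductSpace ℝ E]

theorem OrthonormalBasis.finrank_span_image {n : ℕ} (b : OrthonormalBasis (Fin n) ℝ E)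
    (s : Finset (Fin n)) : finrank ℝ (Submodule.span ℝ (b '' s)) = s.card := by
  classical
  have h : LinearIndependent ℝ fun i : s => b i :=
    b.orthonormal.linearIndependent.comp _ Subtype.val_injective
  have := finrank_span_eq_card h
  rw [show Set.range (fun i : s => b i) = b '' s by ext; simp] at this
  simpa using this

theorem OrthonormalBasis.inner_eq_zero_of_mem_span {n : ℕ}
    (b : OrthonormalBasis (Fin n) ℝ E) {s : Finset (Fin n)} {x : E}
    (hx : x ∈ Submodule.span ℝ (b '' s)) {i : Fin n} (hi : i ∉ s) : inner ℝ (b i) x = 0 := by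
  induction hx using Submodule.span_induction with
  | mem x hx =>
    obtain ⟨j, hj, rfl⟩ := hx
    exact b.orthonormal.2 fun h => hi (h ▸ hj)
  | zero => simp
  | add x y _ _ hx hy => simp [inner_add_right, hx, hy]
  | smul a x _ hx => simp [inner_smul_right, hx]

end OrthonormalBasis

namespace LinearMap

open Module

/-! ### Singular values: min-max comparison and Horn's inequality -/

section SingularValues

variable {E F G : Type*} [NormedAddCommGroup E] [InnerProductSpace ℝ E] [FiniteDimensional ℝ E]
  [NormedAddCommGroup F] [InnerProductSpace ℝ F] [FiniteDimensional ℝ F]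
  [NormedAddCommGroup G] [InnerProductSpace ℝ G] [FiniteDimensional ℝ G]

/-- An orthonormal basis of right singular vectors, ordered like the singular values. -/
def rightSingularBasis (f : E →ₗ[ℝ] F) {n : ℕ} (hn : finrank ℝ E = n) :
    OrthonormalBasis (Fin n) ℝ E :=
  f.isSymmetric_adjoint_comp_self.eigenvectorBasis hn

theorem adjoint_apply_rightSingularBasis (f : E →ₗ[ℝ] F) {n : ℕ} (hn : finrank ℝ E = n)
    (i : Fin n) :
    f.adjoint (f (f.rightSingularBasis hn i)) =
      (f.singularValues i ^ 2) • f.rightSingularBasis hn i := by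
  rw [sq_singularValues_fin f hn]
  exact f.isSymmetric_adjoint_comp_self.apply_eigenvectorBasis hn i

theorem inner_apply_rightSingularBasis (f : E →ₗ[ℝ] F) {n : ℕ} (hn : finrank ℝ E = n)
    (i : Fin n) (x : E) :
    inner ℝ (f (f.rightSingularBasis hn i)) (f x) =
      f.singularValues i ^ 2 * inner ℝ (f.rightSingularBasis hn i) x := by
  rw [← adjoint_inner_left, adjoint_apply_rightSingularBasis, inner_smul_left]
  simp

theorem norm_sq_apply_eq_sum_singularValues (f : E →ₗ[ℝ] F) {n : ℕ} (hn : finrank ℝ E = n)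
    (x : E) :
    ‖f x‖ ^ 2 =
      ∑ i : Fin n, f.singularValues i ^ 2 * inner ℝ (f.rightSingularBasis hn i) x ^ 2 := by
  rw [← real_inner_self_eq_norm_sq]
  conv_lhs => enter [2]; rw [← (f.rightSingularBasis hn).sum_repr x]
  simp only [map_sum, map_smul, sum_inner, inner_smul_left, OrthonormalBasis.repr_apply_apply,
    inner_apply_rightSingularBasis]
  refine Finset.sum_congr rfl fun i _ => ?_
  simp
  ring

theorem norm_apply_rightSingularBasis (f : E →ₗ[ℝ] F) {n : ℕ} (hn : finrank ℝ E = n)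
    (i : Fin n) : ‖f (f.rightSingularBasis hn i)‖ = f.singularValues i := by
  rw [← sq_eq_sq₀ (norm_nonneg _) (f.singularValues_nonneg _), ← real_inner_self_eq_norm_sq,
    inner_apply_rightSingularBasis]
  simp

theorem singularValues_le_of_norm_le (f : E →ₗ[ℝ] F) {C : ℝ} (hf : ∀ x, ‖f x‖ ≤ C * ‖x‖)
    {i : ℕ} (hi : i < finrank ℝ E) : f.singularValues i ≤ C := by
  have := hf (f.rightSingularBasis rfl ⟨i, hi⟩)
  rw [norm_apply_rightSingularBasis] at this
  simpa using this

theorem le_singularValues_of_le_norm (f : E →ₗ[ℝ] F) {c : ℝ} (hf : ∀ x, c * ‖x‖ ≤ ‖f x‖)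
    {i : ℕ} (hi : i < finrank ℝ E) : c ≤ f.singularValues i := by
  have := hf (f.rightSingularBasis rfl ⟨i, hi⟩)
  rw [norm_apply_rightSingularBasis] at this
  simpa using this

/-- Precomposing with an injective map of norm at most `K` multiplies each singular value by at
most `K`. -/
theorem singularValues_comp_le (f : F →ₗ[ℝ] G) (ι : E →ₗ[ℝ] F) (hι : Function.Injective ι)
    {K : ℝ} (hK0 : 0 ≤ K) (hK : ∀ x, ‖ι x‖ ≤ K * ‖x‖) {i : ℕ} (hi : i < finrank ℝ E) :
    (f ∘ₗ ι).singularValues i ≤ f.singularValues i * K := by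
  set g := f ∘ₗ ι
  have hEF : finrank ℝ E ≤ finrank ℝ F := finrank_le_finrank_of_injective hι
  set b := g.rightSingularBasis rfl
  set e := f.rightSingularBasis rfl
  set s : Finset (Fin (finrank ℝ E)) := Finset.Iic ⟨i, hi⟩
  set t : Finset (Fin (finrank ℝ F)) := Finset.Ici ⟨i, hi.trans_le hEF⟩
  -- Courant–Fischer argument: `g` stretches by at least its singular value of index `i` on the span
  -- of `b '' s`, and `f` by at most its own on `W`. Since `dim V + dim W = dim F + 1`, the two
  -- subspaces share a nonzero vector, on which both bounds apply.
  set V := (Submodule.span ℝ (b '' s)).map ι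
  set W := Submodule.span ℝ (e '' t)
  have hV : finrank ℝ V = i + 1 := by
    rw [← (Submodule.equivMapOfInjective ι hι _).finrank_eq,
      OrthonormalBasis.finrank_span_image]
    simp [s]
  have hW : finrank ℝ W = finrank ℝ F - i := by
    rw [OrthonormalBasis.finrank_span_image]
    simp [t]
  obtain ⟨y, hy, hy0⟩ : ∃ y ∈ V ⊓ W, y ≠ 0 := by
    rw [← Submodule.ne_bot_iff]
    intro h
    have h1 := Submodule.finrank_sup_add_finrank_inf_eq V W
    have h2 := Submodule.finrank_le (V ⊔ W)
    rw [h, finrank_bot] at h1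
    omega
  obtain ⟨⟨x, hx, rfl⟩, hyW⟩ := hy
  have hx0 : 0 < ‖x‖ := by
    rw [norm_pos_iff]
    rintro rfl
    simp at hy0
  have h1 : g.singularValues i ^ 2 * ‖x‖ ^ 2 ≤ ‖g x‖ ^ 2 := by
    rw [norm_sq_apply_eq_sum_singularValues g rfl, ← b.sum_sq_inner_right x, Finset.mul_sum]
    refine Finset.sum_le_sum fun k _ => ?_
    by_cases hk : k ∈ s
    · gcongr
      · exact g.singularValues_nonneg _
      · exact g.singularValues_antitone (Fin.le_def.1 (Finset.mem_Iic.1 hk))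
    · have := b.inner_eq_zero_of_mem_span hx hk
      simp [b] at this
      simp [b, this]
  have h2 : ‖f (ι x)‖ ^ 2 ≤ f.singularValues i ^ 2 * ‖ι x‖ ^ 2 := by
    rw [norm_sq_apply_eq_sum_singularValues f rfl, ← e.sum_sq_inner_right (ι x), Finset.mul_sum]
    refine Finset.sum_le_sum fun k _ => ?_
    by_cases hk : k ∈ t
    · gcongr
      · exact f.singularValues_nonneg _
      · exact f.singularValues_antitone (Fin.le_def.1 (Finset.mem_Ici.1 hk))
    · have := e.inner_eq_zero_of_mem_span hyW hk
      simp [e] at this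
      simp [e, this]
  have h3 : g.singularValues i ^ 2 * ‖x‖ ^ 2 ≤ (f.singularValues i * K) ^ 2 * ‖x‖ ^ 2 :=
    calc _ ≤ f.singularValues i ^ 2 * ‖ι x‖ ^ 2 := h1.trans h2
      _ ≤ f.singularValues i ^ 2 * (K * ‖x‖) ^ 2 := by gcongr; exact hK x
      _ = _ := by ring
  exact le_of_sq_le_sq (le_of_mul_le_mul_right h3 (by positivity))
    (mul_nonneg (f.singularValues_nonneg _) hK0)

/-- Singular values do not increase when a map is precomposed with a linear isometry. -/
theorem singularValues_comp_linearIsometry_le (f : F →ₗ[ℝ] G) (ι : E →ₗᵢ[ℝ] F) {i : ℕ}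
    (hi : i < finrank ℝ E) :
    (f ∘ₗ ι.toLinearMap).singularValues i ≤ f.singularValues i := by
  simpa using singularValues_comp_le f ι.toLinearMap ι.injective zero_le_one (by simp) hi

theorem normDet_domRestrict_le_prod_singularValues (f : F →ₗ[ℝ] G) (p : Submodule ℝ F) :
    (f.domRestrict p).normDet ≤ ∏ i ∈ Finset.range (finrank ℝ p), f.singularValues i := by
  rw [normDet_eq_prod_singularValues]
  refine Finset.prod_le_prod (fun i _ => singularValues_nonneg _ _) fun i hi => ?_
  exact singularValues_comp_linearIsometry_le f p.subtypeₗᵢ (Finset.mem_range.1 hi)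

/-- Sending the standard basis to the first `j` right singular vectors works: their images under `f`
are orthogonal with lengths the singular values, so the Gram matrix is diagonal. -/
theorem exists_linearIsometry_normDet_comp_eq (f : F →ₗ[ℝ] G) {j : ℕ} (hj : j ≤ finrank ℝ F) :
    ∃ ι : EuclideanSpace ℝ (Fin j) →ₗᵢ[ℝ] F,
      (f ∘ₗ ι.toLinearMap).normDet = ∏ i ∈ Finset.range j, f.singularValues i := by
  set e := f.rightSingularBasis rfl
  have ho : Orthonormal ℝ fun a : Fin j => e (Fin.castLE hj a) :=
    e.orthonormal.comp _ (Fin.castLE_injective hj)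
  set b := EuclideanSpace.basisFun (Fin j) ℝ
  let ι : EuclideanSpace ℝ (Fin j) →ₗᵢ[ℝ] F :=
    (b.toBasis.constr ℝ fun a : Fin j => e (Fin.castLE hj a)).isometryOfOrthonormal
      (v := b.toBasis) (by simp) (by
        convert! ho using 1
        ext a
        simp)
  have hι : ∀ a, ι (b a) = e (Fin.castLE hj a) := fun a => by
    have := b.toBasis.constr_basis ℝ (fun a : Fin j => e (Fin.castLE hj a)) a
    rwa [OrthonormalBasis.coe_toBasis] at this
  refine ⟨ι, ?_⟩
  rw [← sq_eq_sq₀ (normDet_nonneg _) (Finset.prod_nonneg fun i _ => f.singularValues_nonneg i)]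
  have h := normDet_sq_eq_det_gram (f ∘ₗ ι.toLinearMap) b
  have hg : Matrix.gram ℝ (fun a => (f ∘ₗ ι.toLinearMap) (b a)) =
      Matrix.diagonal fun a : Fin j => f.singularValues a ^ 2 := by
    ext a c
    rw [Matrix.gram_apply]
    simp only [coe_comp, Function.comp_apply, LinearIsometry.coe_toLinearMap, hι, e,
      inner_apply_rightSingularBasis]
    rw [OrthonormalBasis.inner_eq_ite, Matrix.diagonal_apply]
    by_cases hac : a = c <;> simp [hac]
  rw [hg, Matrix.det_diagonal] at h
  rw [show (f ∘ₗ ι.toLinearMap).normDet ^ 2 = _ from h, Finset.prod_range, Finset.prod_pow]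

/-- Horn's inequality: the product of the `j` largest singular values is submultiplicative. -/
theorem prod_singularValues_comp_le (f : F →ₗ[ℝ] G) (g : E →ₗ[ℝ] F)
    (hg : Function.Injective g) {j : ℕ} (hj : j ≤ finrank ℝ E) :
    ∏ i ∈ Finset.range j, (f ∘ₗ g).singularValues i ≤
      (∏ i ∈ Finset.range j, f.singularValues i) * ∏ i ∈ Finset.range j, g.singularValues i := by
  obtain ⟨ι, hι⟩ := (f ∘ₗ g).exists_linearIsometry_normDet_comp_eq hj
  -- The `j`-dimensional volume factor of `f ∘ g ∘ ι` is that of `f` on the range of `g ∘ ι` times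
  -- that of `g ∘ ι`. Injectivity of `g` makes this range exactly `j`-dimensional.
  rw [← hι, LinearMap.comp_assoc, normDet_comp]
  have hr : finrank ℝ (g ∘ₗ ι.toLinearMap).range = j := by
    rw [LinearMap.finrank_range_of_inj (show Function.Injective (g ∘ ι) from hg.comp ι.injective)]
    simp
  gcongr
  · exact normDet_nonneg _
  · exact Finset.prod_nonneg fun i _ => f.singularValues_nonneg i
  · simpa [hr] using f.normDet_domRestrict_le_prod_singularValues (g ∘ₗ ι.toLinearMap).range
  · rw [normDet_eq_prod_singularValues, finrank_euclideanSpace_fin]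
    exact Finset.prod_le_prod (fun i _ => singularValues_nonneg _ _) fun i hi =>
      singularValues_comp_linearIsometry_le g ι (by simpa using hi)

end SingularValues

end LinearMap

/-! ### The singular value function: dependence on the exponent, submultiplicativity -/

namespace AlmostSelfAffine

/-- The exponent of the singular value `α_{i+1}` in `φ^s`. -/
def singularValueWeight (N : ℕ) (s : ℝ) (i : ℕ) : ℝ :=
  if s < N then min s (i + 1) - min s i else s / N

/-- Below `N` the weight is the length of `[i, i+1] ∩ (-∞, s]` for `s ≥ i` and zero otherwise.
Passing from `s < N` to `t ≥ N` is harmless because the first weight is at most `1` and the second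
at least `1`. -/
theorem singularValueWeight_mono {N : ℕ} {s t : ℝ} (hst : s ≤ t) {i : ℕ}
    (hi : i < N) : singularValueWeight N s i ≤ singularValueWeight N t i := by
  have hN : (0 : ℝ) < N := by exact_mod_cast (Nat.zero_le i).trans_lt hi
  unfold singularValueWeight
  split_ifs with h1 h2 h2
  · rcases le_total s i with a | a <;> rcases le_total s (i + 1) with b | b <;>
    rcases le_total t i with c | c <;> rcases le_total t (i + 1) with d | d <;>
    simp only [a, b, c, d, min_eq_left, min_eq_right] <;> linarith
  · have : 1 ≤ t / N := by rw [le_div_iff₀ hN]; linarith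
    have : min s ((i : ℝ) + 1) - min s i ≤ 1 := by
      rcases le_total s i with a | a <;> rcases le_total s (i + 1) with b | b <;>
      simp only [a, b, min_eq_left, min_eq_right] <;> linarith
    linarith
  · linarith
  · gcongr

theorem sum_singularValueWeight {N : ℕ} (hN : 1 ≤ N) {s : ℝ} (h0 : 0 ≤ s) :
    ∑ i ∈ Finset.range N, singularValueWeight N s i = s := by
  have hN' : (N : ℝ) ≠ 0 := by positivity
  unfold singularValueWeight
  split_ifs with h
  · have := Finset.sum_range_sub (fun i : ℕ => min s (i : ℝ)) N
    push_cast at this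
    rw [this]
    simp [h.le, h0]
  · simp; field_simp

section SingularValueFunction

variable {N : ℕ} {L M : EuclideanSpace ℝ (Fin N) →L[ℝ] EuclideanSpace ℝ (Fin N)}

theorem singularValues_pos (hL : Function.Injective L) {i : ℕ} (hi : i < N) :
    0 < L.toLinearMap.singularValues i :=
  (LinearMap.injective_iff_forall_lt_finrank_singularValues_pos _).1 hL i (by simpa using hi)

theorem prod_singularValues_pos (hL : Function.Injective L) {j : ℕ} (hj : j ≤ N) :
    0 < ∏ i ∈ Finset.range j, L.toLinearMap.singularValues i :=
  Finset.prod_pos fun _ hi => singularValues_pos hL ((Finset.mem_range.1 hi).trans_le hj)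

theorem singularValueFunction_pos (hL : Function.Injective L) {s : ℝ} (h0 : 0 ≤ s) :
    0 < singularValueFunction s L := by
  unfold singularValueFunction
  split_ifs with h
  · have hj : ⌊s⌋₊ < N := (Nat.floor_lt h0).2 h
    exact mul_pos (prod_singularValues_pos hL hj.le)
      (Real.rpow_pos_of_pos (singularValues_pos hL hj) _)
  · exact Real.rpow_pos_of_pos (prod_singularValues_pos hL le_rfl) _

theorem log_singularValueFunction (hL : Function.Injective L) {s : ℝ} (h0 : 0 ≤ s) :
    Real.log (singularValueFunction s L) =
      ∑ i ∈ Finset.range N, singularValueWeight N s i * Real.log (L.toLinearMap.singularValues i) := by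
  unfold singularValueFunction singularValueWeight
  split_ifs with h
  · have hj : ⌊s⌋₊ < N := (Nat.floor_lt h0).2 h
    have h1 := Nat.floor_le h0
    have h2 := Nat.lt_floor_add_one s
    rw [Real.log_mul (prod_singularValues_pos hL hj.le).ne'
      (Real.rpow_pos_of_pos (singularValues_pos hL hj) _).ne',
      Real.log_rpow (singularValues_pos hL hj), Real.log_prod]
    · rw [← Finset.sum_subset (Finset.range_mono hj), Finset.sum_range_succ]
      · congr 1
        · refine Finset.sum_congr rfl fun i hi => ?_
          have hi' : (i : ℝ) + 1 ≤ s := by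
            have : i + 1 ≤ ⌊s⌋₊ := Finset.mem_range.1 hi
            exact le_trans (by exact_mod_cast this) h1
          rw [min_eq_right hi', min_eq_right (by linarith)]
          ring
        · rw [min_eq_left h2.le, min_eq_right h1]
      · intro i _ hi
        have hi' : s ≤ i := by
          have : ⌊s⌋₊ + 1 ≤ i := by simpa using hi
          exact h2.le.trans (by exact_mod_cast this)
        rw [min_eq_left hi', min_eq_left (by linarith)]
        simp
    · exact fun i hi => (singularValues_pos hL ((Finset.mem_range.1 hi).trans hj)).ne'
  · rw [Real.log_rpow (prod_singularValues_pos hL le_rfl), Real.log_prod, Finset.mul_sum]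
    exact fun i hi => (singularValues_pos hL (Finset.mem_range.1 hi)).ne'

/-- The increments of the weights from `s` to `t` are nonnegative and add up to `t - s`, so a common
bound on the logarithms of the singular values passes to the weighted sum. -/
theorem log_singularValueFunction_sub_le (hN : 1 ≤ N) (hL : Function.Injective L) {s t C : ℝ}
    (h0 : 0 ≤ s) (hst : s ≤ t) (hC : ∀ i < N, Real.log (L.toLinearMap.singularValues i) ≤ C) :
    Real.log (singularValueFunction t L) - Real.log (singularValueFunction s L) ≤ (t - s) * C := by
  rw [log_singularValueFunction hL h0, log_singularValueFunction hL (h0.trans hst),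
    ← Finset.sum_sub_distrib]
  calc _ ≤ ∑ i ∈ Finset.range N, (singularValueWeight N t i - singularValueWeight N s i) * C := by
        refine Finset.sum_le_sum fun i hi => ?_
        rw [← sub_mul]
        exact mul_le_mul_of_nonneg_left (hC i (Finset.mem_range.1 hi))
          (sub_nonneg.2 (singularValueWeight_mono hst (Finset.mem_range.1 hi)))
    _ = _ := by
      rw [← Finset.sum_mul, Finset.sum_sub_distrib, sum_singularValueWeight hN h0,
        sum_singularValueWeight hN (h0.trans hst)]

theorem le_log_singularValueFunction_sub (hN : 1 ≤ N) (hL : Function.Injective L) {s t c : ℝ}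
    (h0 : 0 ≤ s) (hst : s ≤ t) (hc : ∀ i < N, c ≤ Real.log (L.toLinearMap.singularValues i)) :
    (t - s) * c ≤ Real.log (singularValueFunction t L) - Real.log (singularValueFunction s L) := by
  rw [log_singularValueFunction hL h0, log_singularValueFunction hL (h0.trans hst),
    ← Finset.sum_sub_distrib]
  calc (t - s) * c
      = ∑ i ∈ Finset.range N, (singularValueWeight N t i - singularValueWeight N s i) * c := by
        rw [← Finset.sum_mul, Finset.sum_sub_distrib, sum_singularValueWeight hN h0,
          sum_singularValueWeight hN (h0.trans hst)]
    _ ≤ _ := by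
      refine Finset.sum_le_sum fun i hi => ?_
      rw [← sub_mul]
      exact mul_le_mul_of_nonneg_left (hc i (Finset.mem_range.1 hi))
        (sub_nonneg.2 (singularValueWeight_mono hst (Finset.mem_range.1 hi)))

theorem singularValueFunction_zero (hN : 1 ≤ N) : singularValueFunction 0 L = 1 := by
  have : (0 : ℝ) < N := by exact_mod_cast hN
  simp [singularValueFunction, this]

theorem prod_singularValues_mul_le (hM : Function.Injective M) {j : ℕ}
    (hj : j ≤ N) :
    ∏ i ∈ Finset.range j, (L * M).toLinearMap.singularValues i ≤
      (∏ i ∈ Finset.range j, L.toLinearMap.singularValues i) *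
        ∏ i ∈ Finset.range j, M.toLinearMap.singularValues i :=
  LinearMap.prod_singularValues_comp_le L.toLinearMap M.toLinearMap hM (by simpa using hj)

/-- Writes `φ^s` as a geometric mean of the products of the first `⌊s⌋` and `⌊s⌋ + 1` singular
values; each is submultiplicative by Horn's inequality, hence so is `φ^s`. -/
theorem singularValueFunction_eq_interpolation (hL : Function.Injective L) {s : ℝ} (h0 : 0 ≤ s)
    (h : s < N) :
    singularValueFunction s L =
      (∏ i ∈ Finset.range ⌊s⌋₊, L.toLinearMap.singularValues i) ^ (1 - (s - ⌊s⌋₊)) *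
        (∏ i ∈ Finset.range (⌊s⌋₊ + 1), L.toLinearMap.singularValues i) ^ (s - ⌊s⌋₊) := by
  have hj : ⌊s⌋₊ < N := (Nat.floor_lt h0).2 h
  have hp := prod_singularValues_pos hL hj.le
  rw [singularValueFunction, if_pos h, Finset.prod_range_succ,
    Real.mul_rpow hp.le (singularValues_pos hL hj).le, ← mul_assoc, ← Real.rpow_add hp]
  simp

theorem singularValueFunction_mul_le (hL : Function.Injective L) (hM : Function.Injective M)
    {s : ℝ} (h0 : 0 ≤ s) :
    singularValueFunction s (L * M) ≤ singularValueFunction s L * singularValueFunction s M := by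
  have hLM : Function.Injective (L * M) := hL.comp hM
  by_cases h : s < N
  · have hj : ⌊s⌋₊ < N := (Nat.floor_lt h0).2 h
    have h1 := sub_nonneg.2 (Nat.floor_le h0)
    have h2 : 0 ≤ 1 - (s - ⌊s⌋₊) := by linarith [Nat.lt_floor_add_one s]
    rw [singularValueFunction_eq_interpolation hLM h0 h,
      singularValueFunction_eq_interpolation hL h0 h,
      singularValueFunction_eq_interpolation hM h0 h, mul_mul_mul_comm,
      ← Real.mul_rpow (prod_singularValues_pos hL hj.le).le (prod_singularValues_pos hM hj.le).le,
      ← Real.mul_rpow (prod_singularValues_pos hL hj).le (prod_singularValues_pos hM hj).le]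
    have a1 := prod_singularValues_pos hLM hj.le
    have a2 := prod_singularValues_pos hLM hj
    gcongr
    · exact Real.rpow_nonneg
        (mul_pos (prod_singularValues_pos hL hj.le) (prod_singularValues_pos hM hj.le)).le _
    · exact prod_singularValues_mul_le hM hj.le
    · exact prod_singularValues_mul_le hM hj
  · simp only [singularValueFunction, if_neg h]
    rw [← Real.mul_rpow (prod_singularValues_pos hL le_rfl).le
      (prod_singularValues_pos hM le_rfl).le]
    exact Real.rpow_le_rpow (prod_singularValues_pos hLM le_rfl).le
      (prod_singularValues_mul_le hM le_rfl) (by positivity)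

/-- Each singular value of `L` is controlled by that of `L * M` when `M` is bounded below. -/
theorem mul_singularValues_le_mul {c : ℝ} (hc : 0 < c) (hM : ∀ x, c * ‖x‖ ≤ ‖M x‖) {i : ℕ}
    (hi : i < N) :
    c * L.toLinearMap.singularValues i ≤ (L * M).toLinearMap.singularValues i := by
  have hinj : Function.Injective M.toLinearMap := by
    rw [injective_iff_map_eq_zero]
    intro x hx
    have := hM x
    rw [show M x = 0 from hx, norm_zero] at this
    exact norm_eq_zero.1 (le_antisymm (nonpos_of_mul_nonpos_right this hc) (norm_nonneg _))
  -- `L` is `L * M` precomposed with `M⁻¹`, whose norm is at most `c⁻¹`.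
  set e := LinearEquiv.ofInjectiveEndo M.toLinearMap hinj
  have he : ∀ x, M (e.symm x) = x := fun x => e.apply_symm_apply x
  have h := LinearMap.singularValues_comp_le (L * M).toLinearMap e.symm.toLinearMap e.symm.injective
    (inv_nonneg.2 hc.le) (fun x => by
      rw [inv_mul_eq_div, le_div_iff₀ hc, mul_comm]
      simpa [he] using hM (e.symm x)) (i := i) (by simpa using hi)
  have hcomp : (L * M).toLinearMap ∘ₗ e.symm.toLinearMap = L.toLinearMap := by
    ext1 x
    exact congrArg L (he x)
  rw [hcomp, ← div_eq_mul_inv, le_div_iff₀ hc] at h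
  linarith

end SingularValueFunction

/-! ### Words: norm bounds, probabilities and costs -/

section Words

variable {N m : ℕ} {T : Fin m → EuclideanSpace ℝ (Fin N) →L[ℝ] EuclideanSpace ℝ (Fin N)}

theorem wordMap_append (u v : List (Fin m)) : wordMap T (u ++ v) = wordMap T u * wordMap T v := by
  simp [wordMap]

theorem wordMap_cons (a : Fin m) (v : List (Fin m)) : wordMap T (a :: v) = T a * wordMap T v := by
  simp [wordMap]

theorem wordMap_injective (hT : ∀ a, Function.Injective (T a)) (u : List (Fin m)) :
    Function.Injective (wordMap T u) := by
  induction u with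
  | nil => exact Function.injective_id
  | cons a u ih => rw [wordMap_cons]; exact (hT a).comp ih

theorem exists_uniform_norm_bounds (hT : ∀ a, Function.Injective (T a)) (hT1 : ∀ a, ‖T a‖ < 1) :
    ∃ c C : ℝ, 0 < c ∧ 0 < C ∧ C < 1 ∧
      (∀ a x, c * ‖x‖ ≤ ‖T a x‖) ∧ ∀ a x, ‖T a x‖ ≤ C * ‖x‖ := by
  have h1 : ∀ a, ∃ c > 0, ∀ x, c * ‖x‖ ≤ ‖T a x‖ := by
    intro a
    obtain ⟨K, hK, hK'⟩ := (T a).toLinearMap.exists_antilipschitzWith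
      (LinearMap.ker_eq_bot.2 (hT a))
    refine ⟨(K : ℝ)⁻¹, by positivity, fun x => ?_⟩
    have := hK'.le_mul_norm_sub x 0
    rw [inv_mul_le_iff₀ (by positivity)]
    simpa using this
  choose c hc hcx using h1
  rcases isEmpty_or_nonempty (Fin m) with h | h
  · exact ⟨1, 1 / 2, by norm_num, by norm_num, by norm_num, fun a => h.elim a, fun a => h.elim a⟩
  · obtain ⟨a₀, ha₀⟩ := Finite.exists_min c
    obtain ⟨a₁, ha₁⟩ := Finite.exists_max fun a => ‖T a‖
    refine ⟨c a₀, max ‖T a₁‖ (1 / 2), hc _, by positivity, max_lt (hT1 _) (by norm_num),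
      fun a x => (mul_le_mul_of_nonneg_right (ha₀ a) (norm_nonneg _)).trans (hcx a x),
      fun a x => (T a).le_of_opNorm_le ((ha₁ a).trans (le_max_left _ _)) x⟩

theorem le_norm_wordMap {c : ℝ} (hc : 0 < c) (h : ∀ a x, c * ‖x‖ ≤ ‖T a x‖) (u : List (Fin m))
    (x : EuclideanSpace ℝ (Fin N)) : c ^ u.length * ‖x‖ ≤ ‖wordMap T u x‖ := by
  induction u with
  | nil => simp [wordMap]
  | cons a u ih =>
    rw [wordMap_cons, List.length_cons, pow_succ', mul_assoc]
    exact (mul_le_mul_of_nonneg_left ih hc.le).trans (h a _)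

theorem norm_wordMap_le {C : ℝ} (hC : 0 < C) (h : ∀ a x, ‖T a x‖ ≤ C * ‖x‖) (u : List (Fin m))
    (x : EuclideanSpace ℝ (Fin N)) : ‖wordMap T u x‖ ≤ C ^ u.length * ‖x‖ := by
  induction u with
  | nil => simp [wordMap]
  | cons a u ih =>
    rw [wordMap_cons, List.length_cons, pow_succ', mul_assoc]
    exact (h a _).trans (mul_le_mul_of_nonneg_left ih hC.le)

theorem le_log_singularValues_wordMap {c : ℝ} (hc : 0 < c) (h : ∀ a x, c * ‖x‖ ≤ ‖T a x‖)
    (u : List (Fin m)) {i : ℕ} (hi : i < N) :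
    u.length * Real.log c ≤ Real.log ((wordMap T u).toLinearMap.singularValues i) := by
  rw [← Real.log_pow]
  exact Real.log_le_log (by positivity)
    (LinearMap.le_singularValues_of_le_norm _ (le_norm_wordMap hc h u) (by simpa using hi))

theorem singularValues_wordMap_le {C : ℝ} (hC : 0 < C) (h : ∀ a x, ‖T a x‖ ≤ C * ‖x‖)
    (u : List (Fin m)) {i : ℕ} (hi : i < N) :
    (wordMap T u).toLinearMap.singularValues i ≤ C ^ u.length :=
  LinearMap.singularValues_le_of_norm_le _ (norm_wordMap_le hC h u) (by simpa using hi)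

theorem log_singularValues_wordMap_le (hT : ∀ a, Function.Injective (T a)) {C : ℝ} (hC : 0 < C)
    (h : ∀ a x, ‖T a x‖ ≤ C * ‖x‖) (u : List (Fin m)) {i : ℕ} (hi : i < N) :
    Real.log ((wordMap T u).toLinearMap.singularValues i) ≤ u.length * Real.log C := by
  rw [← Real.log_pow]
  exact Real.log_le_log (singularValues_pos (wordMap_injective hT u) hi)
    (singularValues_wordMap_le hC h u hi)

/-- The product `p_{u₁} ⋯ p_{u_k}` along a word. -/
def wordProb (p : PMF (Fin m)) (u : List (Fin m)) : ℝ :=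
  (u.map fun a => (p a).toReal).prod

theorem wordProb_append (p : PMF (Fin m)) (u v : List (Fin m)) :
    wordProb p (u ++ v) = wordProb p u * wordProb p v := by
  simp [wordProb]

theorem toReal_pmf_pos {p : PMF (Fin m)} (hp : ∀ a, 0 < p a) (a : Fin m) : 0 < (p a).toReal :=
  ENNReal.toReal_pos (hp a).ne' (p.apply_ne_top a)

theorem wordProb_pos {p : PMF (Fin m)} (hp : ∀ a, 0 < p a) (u : List (Fin m)) :
    0 < wordProb p u := by
  induction u with
  | nil => simp [wordProb]
  | cons a u ih => simpa [wordProb] using mul_pos (toReal_pmf_pos hp a) ih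

theorem log_wordProb_le {p : PMF (Fin m)} (hp : ∀ a, 0 < p a) {q : ℝ}
    (hq : ∀ a, Real.log (p a).toReal ≤ q) (u : List (Fin m)) :
    Real.log (wordProb p u) ≤ u.length * q := by
  induction u with
  | nil => simp [wordProb]
  | cons a u ih =>
    have : wordProb p (a :: u) = (p a).toReal * wordProb p u := by simp [wordProb]
    rw [this, Real.log_mul (toReal_pmf_pos hp a).ne' (wordProb_pos hp u).ne', List.length_cons]
    push_cast
    linarith [hq a]

theorem le_log_wordProb {p : PMF (Fin m)} (hp : ∀ a, 0 < p a) {q : ℝ}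
    (hq : ∀ a, q ≤ Real.log (p a).toReal) (u : List (Fin m)) :
    u.length * q ≤ Real.log (wordProb p u) := by
  induction u with
  | nil => simp [wordProb]
  | cons a u ih =>
    have : wordProb p (a :: u) = (p a).toReal * wordProb p u := by simp [wordProb]
    rw [this, Real.log_mul (toReal_pmf_pos hp a).ne' (wordProb_pos hp u).ne', List.length_cons]
    push_cast
    linarith [hq a]

theorem real_wordCylinder {k : ℕ} (p : PMF (Fin m)) (u : Fin k → Fin m) :
    (bernoulliMeasure p).real (wordCylinder u) = wordProb p (List.ofFn u) := by
  rw [Measure.real, bernoulliMeasure_wordCylinder, ENNReal.toReal_prod, wordProb, List.map_ofFn,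
    List.prod_ofFn]
  rfl

theorem length_curtail (i : ℕ → Fin m) (k : ℕ) : (curtail i k).length = k := by simp [curtail]

theorem curtail_add (i : ℕ → Fin m) (k l : ℕ) :
    curtail i (k + l) = curtail i k ++ curtail (fun n => i (k + n)) l := by
  unfold curtail
  rw [List.ofFn_add]
  simp

theorem curtail_succ (i : ℕ → Fin m) (k : ℕ) : curtail i (k + 1) = curtail i k ++ [i k] := by
  rw [curtail_add]
  simp [curtail]

/-- The logarithm of `φ^s(T_u) / μ(C_u)`. -/
def wordCost (T : Fin m → EuclideanSpace ℝ (Fin N) →L[ℝ] EuclideanSpace ℝ (Fin N))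
    (p : PMF (Fin m)) (s : ℝ) (u : List (Fin m)) : ℝ :=
  Real.log (singularValueFunction s (wordMap T u)) - Real.log (wordProb p u)

theorem wordCost_append_le (hT : ∀ a, Function.Injective (T a)) {p : PMF (Fin m)}
    (hp : ∀ a, 0 < p a) {s : ℝ} (h0 : 0 ≤ s) (u v : List (Fin m)) :
    wordCost T p s (u ++ v) ≤ wordCost T p s u + wordCost T p s v := by
  have h := Real.log_le_log
    (singularValueFunction_pos (wordMap_injective hT (u ++ v)) h0)
    ((wordMap_append u v ▸ singularValueFunction_mul_le (wordMap_injective hT u)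
      (wordMap_injective hT v) h0))
  rw [Real.log_mul (singularValueFunction_pos (wordMap_injective hT u) h0).ne'
    (singularValueFunction_pos (wordMap_injective hT v) h0).ne'] at h
  unfold wordCost
  rw [wordProb_append, Real.log_mul (wordProb_pos hp u).ne' (wordProb_pos hp v).ne']
  linarith

theorem pressureOneTerm_eq_sum (hT : ∀ a, Function.Injective (T a)) {p : PMF (Fin m)}
    (hp : ∀ a, 0 < p a) {s : ℝ} (h0 : 0 ≤ s) (k : ℕ) :
    pressureOneTerm T (bernoulliMeasure p) s k =
      -((∑ u : Fin k → Fin m,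
        (bernoulliMeasure p).real (wordCylinder u) * wordCost T p s (List.ofFn u)) / k) := by
  rw [pressureOneTerm, one_div_mul_eq_div, ← neg_div, ← Finset.sum_neg_distrib]
  congr 1
  refine Finset.sum_congr rfl fun u _ => ?_
  have h1 := singularValueFunction_pos (wordMap_injective hT (List.ofFn u)) h0
  rw [real_wordCylinder, Real.log_mul (inv_pos.2 h1).ne' (wordProb_pos hp _).ne', Real.log_inv,
    wordCost]
  ring

end Words

/-! ### Blocks of letters under the Bernoulli measure -/

section Blocks

variable {m : ℕ}

/-- The law of a finite block of letters does not depend on its position. -/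
theorem map_block_bernoulliMeasure (p : PMF (Fin m)) (b k : ℕ) :
    (bernoulliMeasure p).map (fun (i : ℕ → Fin m) (l : Fin k) => i (b + l)) =
      Measure.infinitePi fun _ : Fin k => p.toMeasure :=
  Measure.map_infinitePi_infinitePi_of_inj (f := fun l : Fin k => b + (l : ℕ))
    fun x y h => Fin.ext (by simpa using h)

theorem measurable_block (b k : ℕ) : Measurable fun (i : ℕ → Fin m) (l : Fin k) => i (b + l) := by
  fun_prop

theorem integrable_block (p : PMF (Fin m)) {k : ℕ} (g : (Fin k → Fin m) → ℝ) (b : ℕ) :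
    Integrable (fun i : ℕ → Fin m => g fun l => i (b + l)) (bernoulliMeasure p) := by
  have : Integrable g ((bernoulliMeasure p).map fun (i : ℕ → Fin m) (l : Fin k) => i (b + l)) := by
    rw [map_block_bernoulliMeasure]
    exact Integrable.of_finite
  exact this.comp_measurable (measurable_block b k)

/-- Turns the sum over words in the pressure into an expectation, and shows that this expectation
does not depend on the position `b` of the block. -/
theorem integral_block (p : PMF (Fin m)) {k : ℕ} (g : (Fin k → Fin m) → ℝ) (b : ℕ) :
    ∫ i, g (fun l : Fin k => i (b + l)) ∂bernoulliMeasure p =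
      ∑ u : Fin k → Fin m, (bernoulliMeasure p).real (wordCylinder u) * g u := by
  have h := integral_map (μ := bernoulliMeasure p) (measurable_block b k).aemeasurable
    (f := g) (measurable_of_countable g).aestronglyMeasurable
  rw [← h, map_block_bernoulliMeasure, ← map_block_bernoulliMeasure p 0, integral_fintype]
  · refine Finset.sum_congr rfl fun u _ => ?_
    rw [smul_eq_mul, map_measureReal_apply (measurable_block 0 k) (measurableSet_singleton u)]
    congr 2
    ext i
    simp [wordCylinder, funext_iff]
  · exact Integrable.of_finite

end Blocks

/-! ### Existence of the pressure and its unique zero -/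

section Pressure

variable {N m : ℕ} {T : Fin m → EuclideanSpace ℝ (Fin N) →L[ℝ] EuclideanSpace ℝ (Fin N)}
  {p : PMF (Fin m)}

/-- The expected cost of the first `k` letters. -/
def meanCost (T : Fin m → EuclideanSpace ℝ (Fin N) →L[ℝ] EuclideanSpace ℝ (Fin N))
    (p : PMF (Fin m)) (s : ℝ) (k : ℕ) : ℝ :=
  ∫ i, wordCost T p s (curtail i k) ∂bernoulliMeasure p

theorem integrable_wordCost_curtail (s : ℝ) (b k : ℕ) :
    Integrable (fun i : ℕ → Fin m => wordCost T p s (curtail (fun n => i (b + n)) k))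
      (bernoulliMeasure p) :=
  integrable_block p (fun u : Fin k → Fin m => wordCost T p s (List.ofFn u)) b

theorem integral_wordCost_curtail_shift (s : ℝ) (b k : ℕ) :
    ∫ i, wordCost T p s (curtail (fun n => i (b + n)) k) ∂bernoulliMeasure p =
      meanCost T p s k := by
  have h := fun b => integral_block p (fun u : Fin k → Fin m => wordCost T p s (List.ofFn u)) b
  rw [meanCost]
  refine (h b).trans ((h 0).symm.trans ?_)
  simp [curtail]

theorem integrable_wordCost_curtail_zero (s : ℝ) (k : ℕ) :
    Integrable (fun i : ℕ → Fin m => wordCost T p s (curtail i k)) (bernoulliMeasure p) := by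
  simpa using integrable_wordCost_curtail (T := T) (p := p) s 0 k

theorem pressureOneTerm_eq_neg_meanCost_div (hT : ∀ a, Function.Injective (T a))
    (hp : ∀ a, 0 < p a) {s : ℝ} (h0 : 0 ≤ s) (k : ℕ) :
    pressureOneTerm T (bernoulliMeasure p) s k = -(meanCost T p s k / k) := by
  rw [pressureOneTerm_eq_sum hT hp h0,
    ← integral_block p (fun u : Fin k → Fin m => wordCost T p s (List.ofFn u)) 0]
  simp [meanCost, curtail]

theorem subadditive_meanCost (hT : ∀ a, Function.Injective (T a)) (hp : ∀ a, 0 < p a) {s : ℝ}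
    (h0 : 0 ≤ s) : Subadditive (meanCost T p s) := by
  intro k l
  rw [← integral_wordCost_curtail_shift s k l, meanCost, meanCost,
    ← integral_add (integrable_wordCost_curtail_zero s k) (integrable_wordCost_curtail s k l)]
  refine integral_mono (integrable_wordCost_curtail_zero s _)
    ((integrable_wordCost_curtail_zero s k).add (integrable_wordCost_curtail s k l)) fun i => ?_
  simp only [curtail_add]
  exact wordCost_append_le hT hp h0 _ _

theorem log_toReal_pmf_nonpos (p : PMF (Fin m)) (a : Fin m) : Real.log (p a).toReal ≤ 0 :=
  Real.log_nonpos ENNReal.toReal_nonneg (ENNReal.toReal_le_of_le_ofReal zero_le_one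
    (by simpa using p.coe_le_one a))

theorem le_wordCost (hN : 1 ≤ N) (hT : ∀ a, Function.Injective (T a)) (hp : ∀ a, 0 < p a) {c : ℝ}
    (hc : 0 < c) (h : ∀ a x, c * ‖x‖ ≤ ‖T a x‖) {s : ℝ} (h0 : 0 ≤ s) (u : List (Fin m)) :
    s * (u.length * Real.log c) ≤ wordCost T p s u := by
  have h1 := le_log_singularValueFunction_sub hN (wordMap_injective hT u) le_rfl h0
    fun i hi => le_log_singularValues_wordMap hc h u hi
  have h2 := log_wordProb_le hp (log_toReal_pmf_nonpos p) u
  rw [singularValueFunction_zero hN, Real.log_one] at h1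
  rw [wordCost]
  linarith

theorem wordCost_le (hN : 1 ≤ N) (hT : ∀ a, Function.Injective (T a)) (hT1 : ∀ a, ‖T a‖ < 1)
    (hp : ∀ a, 0 < p a) {s : ℝ} (h0 : 0 ≤ s) {q : ℝ} (hq : ∀ a, q ≤ Real.log (p a).toReal)
    (u : List (Fin m)) : wordCost T p s u ≤ u.length * (-q) := by
  have h1 := log_singularValueFunction_sub_le hN (wordMap_injective hT u) le_rfl h0 (C := 0)
    fun i hi => by
      simpa using log_singularValues_wordMap_le hT one_pos
        (fun a x => (T a).le_of_opNorm_le (hT1 a).le x) u hi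
  have h2 := le_log_wordProb hp hq u
  rw [singularValueFunction_zero hN, Real.log_one] at h1
  rw [wordCost]
  linarith

theorem mul_le_meanCost_of_le {s : ℝ} {k : ℕ} {b : ℝ}
    (h : ∀ u : List (Fin m), u.length = k → b ≤ wordCost T p s u) : b ≤ meanCost T p s k := by
  have := integral_mono (μ := bernoulliMeasure p) (integrable_const b)
    (integrable_wordCost_curtail_zero (T := T) s k) fun i => h _ (length_curtail i k)
  simpa [meanCost] using this

theorem meanCost_sub_le {s t : ℝ} {k : ℕ} {b : ℝ}
    (h : ∀ u : List (Fin m), u.length = k → wordCost T p t u - wordCost T p s u ≤ b) :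
    meanCost T p t k - meanCost T p s k ≤ b := by
  rw [meanCost, meanCost, ← integral_sub (integrable_wordCost_curtail_zero t k)
    (integrable_wordCost_curtail_zero s k)]
  have := integral_mono (μ := bernoulliMeasure p) ((integrable_wordCost_curtail_zero t k).sub
    (integrable_wordCost_curtail_zero (T := T) s k)) (integrable_const b)
    fun i => h _ (length_curtail i k)
  simpa using this

/-- Fekete's lemma for the subadditive mean cost; the lower bound comes from the uniform expansion
constant `c`. -/
theorem exists_hasPressureOne (hN : 1 ≤ N) (hT : ∀ a, Function.Injective (T a))
    (hT1 : ∀ a, ‖T a‖ < 1) (hp : ∀ a, 0 < p a) {s : ℝ} (h0 : 0 ≤ s) :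
    ∃ P, HasPressureOne T (bernoulliMeasure p) s P := by
  obtain ⟨c, C, hc, -, -, hcT, -⟩ := exists_uniform_norm_bounds hT hT1
  have hb : BddBelow (Set.range fun k => meanCost T p s k / k) := by
    -- The `0` covers `k = 0`, where the quotient is `0` by convention.
    refine ⟨min 0 (s * Real.log c), ?_⟩
    rintro _ ⟨k, rfl⟩
    rcases Nat.eq_zero_or_pos k with rfl | hk
    · simp
    · refine (min_le_right _ _).trans ?_
      rw [le_div_iff₀ (by exact_mod_cast hk)]
      refine mul_le_meanCost_of_le fun u hu => ?_
      have := le_wordCost hN hT hp hc hcT h0 u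
      rw [hu] at this
      linarith
  refine ⟨_, ((subadditive_meanCost hT hp h0).tendsto_lim hb).neg.congr fun k => ?_⟩
  rw [pressureOneTerm_eq_neg_meanCost_div hT hp h0]

theorem exists_forall_log_pmf_le (hm : 2 ≤ m) (hp : ∀ a, 0 < p a) :
    ∃ q < 0, ∀ a, Real.log (p a).toReal ≤ q := by
  have : Nontrivial (Fin m) := Fin.nontrivial_iff_two_le.2 hm
  obtain ⟨a₀, ha₀⟩ := Finite.exists_max fun a => Real.log (p a).toReal
  refine ⟨_, ?_, ha₀⟩
  refine Real.log_neg (toReal_pmf_pos hp a₀) ?_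
  obtain ⟨b, hb⟩ := exists_ne a₀
  have h1 : p a₀ < 1 := by
    refine lt_of_le_of_ne (p.coe_le_one a₀) fun h => ?_
    rw [PMF.apply_eq_one_iff] at h
    have : b ∈ p.support := (p.mem_support_iff b).2 (hp b).ne'
    rw [h] at this
    exact hb this
  rw [← ENNReal.toReal_one]
  exact (ENNReal.toReal_lt_toReal (p.apply_ne_top _) ENNReal.one_ne_top).2 h1

theorem exists_unique_hasPressureOne_zero (hN : 1 ≤ N) (hm : 2 ≤ m)
    (hT : ∀ a, Function.Injective (T a)) (hT1 : ∀ a, ‖T a‖ < 1) (hp : ∀ a, 0 < p a) :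
    ∃ d : ℝ, 0 < d ∧ HasPressureOne T (bernoulliMeasure p) d 0 ∧
      ∀ s : ℝ, 0 ≤ s → HasPressureOne T (bernoulliMeasure p) s 0 → s = d := by
  obtain ⟨c, C, hc, hC0, hC1, hcT, hCT⟩ := exists_uniform_norm_bounds hT hT1
  choose! P hP using fun (s : ℝ) (h0 : 0 ≤ s) => exists_hasPressureOne hN hT hT1 hp h0
  have hlogC : Real.log C < 0 := Real.log_neg hC0 hC1
  -- `P` increases at a definite rate, which gives uniqueness of the zero and forces `P` to become
  -- nonnegative.
  have hlow : ∀ s t, 0 ≤ s → s ≤ t → (t - s) * (-Real.log C) ≤ P t - P s := by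
    intro s t hs hst
    refine ge_of_tendsto ((hP t (hs.trans hst)).sub (hP s hs)) ?_
    filter_upwards [eventually_gt_atTop 0] with k hk
    have hk' : (0 : ℝ) < k := by exact_mod_cast hk
    rw [pressureOneTerm_eq_neg_meanCost_div hT hp hs,
      pressureOneTerm_eq_neg_meanCost_div hT hp (hs.trans hst)]
    have h := meanCost_sub_le (T := T) (p := p) (s := s) (t := t) (k := k) fun u hu => by
      have := log_singularValueFunction_sub_le hN (wordMap_injective hT u) hs hst
        fun i hi => log_singularValues_wordMap_le hT hC0 hCT u hi
      rw [hu] at this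
      rw [wordCost, wordCost, sub_sub_sub_cancel_right]
      exact this
    have : -(meanCost T p t k / k) - -(meanCost T p s k / k) =
        -((meanCost T p t k - meanCost T p s k) / k) := by ring
    rw [this, mul_neg, neg_le_neg_iff, div_le_iff₀ hk']
    linarith
  have hupp : ∀ s t, 0 ≤ s → s ≤ t → P t - P s ≤ (t - s) * (-Real.log c) := by
    intro s t hs hst
    refine le_of_tendsto ((hP t (hs.trans hst)).sub (hP s hs)) ?_
    filter_upwards [eventually_gt_atTop 0] with k hk
    have hk' : (0 : ℝ) < k := by exact_mod_cast hk
    rw [pressureOneTerm_eq_neg_meanCost_div hT hp hs,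
      pressureOneTerm_eq_neg_meanCost_div hT hp (hs.trans hst)]
    have h := meanCost_sub_le (T := T) (p := p) (s := t) (t := s) (k := k)
      (b := -((t - s) * (k * Real.log c))) fun u hu => by
      have := le_log_singularValueFunction_sub hN (wordMap_injective hT u) hs hst
        fun i hi => le_log_singularValues_wordMap hc hcT u hi
      rw [hu] at this
      rw [wordCost, wordCost, sub_sub_sub_cancel_right]
      linarith
    have : -(meanCost T p t k / k) - -(meanCost T p s k / k) =
        (meanCost T p s k - meanCost T p t k) / k := by ring
    rw [this, div_le_iff₀ hk']
    linarith
  -- As `φ^0 = 1`, `P 0` is minus the entropy of `p`; it is negative because with `m ≥ 2` and all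
  -- weights positive every `p a` is less than `1`.
  have hP0 : P 0 < 0 := by
    obtain ⟨q, hq0, hq⟩ := exists_forall_log_pmf_le hm hp
    refine lt_of_le_of_lt (le_of_tendsto (hP 0 le_rfl) ?_) hq0
    filter_upwards [eventually_gt_atTop 0] with k hk
    have hk' : (0 : ℝ) < k := by exact_mod_cast hk
    rw [pressureOneTerm_eq_neg_meanCost_div hT hp le_rfl, neg_le, le_div_iff₀ hk']
    refine mul_le_meanCost_of_le fun u hu => ?_
    have := log_wordProb_le hp hq u
    rw [hu] at this
    rw [wordCost, singularValueFunction_zero hN, Real.log_one]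
    linarith
  have hcont : ∀ K, ContinuousOn P (Set.Icc 0 K) := by
    intro K
    refine (LipschitzOnWith.of_dist_le_mul (K := Real.toNNReal (|Real.log c|))
      fun x hx y hy => ?_).continuousOn
    rw [Real.coe_toNNReal _ (abs_nonneg _), Real.dist_eq, Real.dist_eq]
    wlog hxy : x ≤ y generalizing x y
    · rw [abs_sub_comm, abs_sub_comm x y]
      exact this y hy x hx (not_le.1 hxy).le
    have h1 := hlow x y hx.1 hxy
    have h2 := hupp x y hx.1 hxy
    rw [abs_sub_comm, abs_sub_comm x y, abs_of_nonneg (sub_nonneg.2 hxy), abs_of_nonneg]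
    · refine h2.trans ?_
      rw [mul_comm]
      exact mul_le_mul_of_nonneg_right (neg_le_abs _) (sub_nonneg.2 hxy)
    · exact (mul_nonneg (sub_nonneg.2 hxy) (by linarith)).trans h1
  -- The point by which growth at rate `-log C` from the value `P 0` must have reached `0`.
  set K := P 0 / Real.log C with hK
  have hK0 : 0 ≤ K := (div_pos_of_neg_of_neg hP0 hlogC).le
  have hPK : 0 ≤ P K := by
    have := hlow 0 K le_rfl hK0
    have h2 : (K - 0) * -Real.log C = - P 0 := by rw [hK, sub_zero, mul_neg, div_mul_cancel₀ _ hlogC.ne]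
    linarith
  obtain ⟨d, hd, hPd⟩ := intermediate_value_Icc hK0 (hcont K) ⟨hP0.le, hPK⟩
  have hd0 : 0 < d := lt_of_le_of_ne hd.1 fun h => by
    rw [← h] at hPd
    linarith
  refine ⟨d, hd0, hPd ▸ hP d hd.1, fun s hs hs0 => ?_⟩
  have hPs : P s = 0 := tendsto_nhds_unique (hP s hs) hs0
  rcases lt_trichotomy s d with h | h | h
  · have := hlow s d hs h.le
    nlinarith [mul_pos (sub_pos.2 h) (neg_pos.2 hlogC)]
  · exact h
  · have := hlow d s hd.1 h.le
    nlinarith [mul_pos (sub_pos.2 h) (neg_pos.2 hlogC)]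

end Pressure

/-! ### Almost sure upper bound for the cost -/

section LargeNumbers

variable {m : ℕ}

theorem indepFun_block (p : PMF (Fin m)) {k a b : ℕ} (hab : a + k ≤ b)
    (g h : (Fin k → Fin m) → ℝ) :
    ProbabilityTheory.IndepFun (fun i : ℕ → Fin m => g fun l => i (a + l))
      (fun i : ℕ → Fin m => h fun l => i (b + l)) (bernoulliMeasure p) := by
  have hind : ProbabilityTheory.iIndepFun (fun (n : ℕ) (i : ℕ → Fin m) => i n)
      (bernoulliMeasure p) :=
    ProbabilityTheory.iIndepFun_infinitePi (P := fun _ : ℕ => p.toMeasure)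
      (X := fun _ x => x) fun _ => measurable_id
  have hdisj : Disjoint (Finset.Ico a (a + k)) (Finset.Ico b (b + k)) := by
    rw [Finset.disjoint_left]
    intro x hx hy
    rw [Finset.mem_Ico] at hx hy
    omega
  have := hind.indepFun_finset _ _ hdisj fun n => measurable_pi_apply n
  exact this.comp
    (φ := fun v : Finset.Ico a (a + k) → Fin m =>
      g fun l => v ⟨a + l, Finset.mem_Ico.2 ⟨by omega, by omega⟩⟩)
    (ψ := fun v : Finset.Ico b (b + k) → Fin m =>
      h fun l => v ⟨b + l, Finset.mem_Ico.2 ⟨by omega, by omega⟩⟩)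
    (measurable_of_countable _) (measurable_of_countable _)

theorem identDistrib_block (p : PMF (Fin m)) {k : ℕ} (g : (Fin k → Fin m) → ℝ) (a b : ℕ) :
    ProbabilityTheory.IdentDistrib (fun i : ℕ → Fin m => g fun l => i (a + l))
      (fun i : ℕ → Fin m => g fun l => i (b + l)) (bernoulliMeasure p) (bernoulliMeasure p) := by
  have hg : Measurable g := measurable_of_countable g
  refine ⟨(hg.comp (measurable_block a k)).aemeasurable,
    (hg.comp (measurable_block b k)).aemeasurable, ?_⟩
  have h := fun b => Measure.map_map (μ := bernoulliMeasure p) hg (measurable_block b k)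
  refine (h a).symm.trans (Eq.trans ?_ (h b))
  rw [map_block_bernoulliMeasure, map_block_bernoulliMeasure]

/-- Strong law of large numbers for consecutive blocks of `k` letters. -/
theorem ae_tendsto_sum_block (p : PMF (Fin m)) {k : ℕ} (g : (Fin k → Fin m) → ℝ) :
    ∀ᵐ i ∂bernoulliMeasure p,
      Tendsto (fun n : ℕ => (∑ b ∈ Finset.range n, g fun l => i (b * k + l)) / (n : ℝ)) atTop
        (𝓝 (∫ i, g (fun l => i l) ∂bernoulliMeasure p)) := by
  have h := ProbabilityTheory.strong_law_ae_real (μ := bernoulliMeasure p)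
    (fun b i => g fun l => i (b * k + l)) (integrable_block p g _) (fun a b hab => by
      rcases hab.lt_or_gt with h | h
      · exact indepFun_block p (by nlinarith) g g
      · exact (indepFun_block p (by nlinarith) g g).symm) (fun b => identDistrib_block p g _ _)
  simpa using h

variable {N : ℕ} {T : Fin m → EuclideanSpace ℝ (Fin N) →L[ℝ] EuclideanSpace ℝ (Fin N)}
  {p : PMF (Fin m)}

theorem wordCost_curtail_mul_add_le (hN : 1 ≤ N) (hT : ∀ a, Function.Injective (T a))
    (hT1 : ∀ a, ‖T a‖ < 1) (hp : ∀ a, 0 < p a) {s : ℝ} (h0 : 0 ≤ s) {q : ℝ}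
    (hq : ∀ a, q ≤ Real.log (p a).toReal) (i : ℕ → Fin m) (n k r : ℕ) :
    wordCost T p s (curtail i (n * k + r)) ≤
      (∑ b ∈ Finset.range n, wordCost T p s (curtail (fun l => i (b * k + l)) k)) + r * (-q) := by
  have h1 : wordCost T p s (curtail i (n * k)) ≤
      ∑ b ∈ Finset.range n, wordCost T p s (curtail (fun l => i (b * k + l)) k) := by
    induction n with
    | zero => simpa [curtail] using wordCost_le hN hT hT1 hp h0 hq []
    | succ n ih =>
      rw [Finset.sum_range_succ, add_one_mul, curtail_add]
      exact (wordCost_append_le hT hp h0 _ _).trans (add_le_add_left ih _)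
  rw [curtail_add]
  refine (wordCost_append_le hT hp h0 _ _).trans (add_le_add h1 ?_)
  simpa [length_curtail] using wordCost_le hN hT hT1 hp h0 hq (curtail (fun l => i (n * k + l)) r)

/-- Vanishing pressure provides a block length `L` with mean cost below `(ε/2) L`. Subadditivity
over the blocks and the strong law give `(ε/2) k` along multiples of `L`; the incomplete last block
costs a bounded amount, absorbed by the other half of `ε`. -/
theorem ae_eventually_wordCost_le (hN : 1 ≤ N) (hT : ∀ a, Function.Injective (T a))
    (hT1 : ∀ a, ‖T a‖ < 1) (hp : ∀ a, 0 < p a) {s : ℝ} (h0 : 0 ≤ s)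
    (hs : HasPressureOne T (bernoulliMeasure p) s 0) {ε : ℝ} (hε : 0 < ε) :
    ∀ᵐ i ∂bernoulliMeasure p, ∀ᶠ k : ℕ in atTop, wordCost T p s (curtail i k) ≤ ε * k := by
  obtain ⟨q, hq0, hq⟩ : ∃ q ≤ 0, ∀ a, q ≤ Real.log (p a).toReal := by
    rcases isEmpty_or_nonempty (Fin m) with h | h
    · exact ⟨0, le_rfl, fun a => h.elim a⟩
    · obtain ⟨a₀, ha₀⟩ := Finite.exists_min fun a => Real.log (p a).toReal
      exact ⟨_, log_toReal_pmf_nonpos p a₀, ha₀⟩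
  obtain ⟨L, hL, hL0⟩ : ∃ L : ℕ, meanCost T p s L < ε / 2 * L ∧ 0 < L := by
    have h1 : Tendsto (fun k : ℕ => meanCost T p s k / k) atTop (𝓝 0) := by
      have := hs.neg
      simp only [pressureOneTerm_eq_neg_meanCost_div hT hp h0, neg_neg, neg_zero] at this
      exact this
    obtain ⟨L, h2, h3⟩ := ((h1.eventually (gt_mem_nhds (half_pos hε))).and
      (eventually_gt_atTop 0)).exists
    exact ⟨L, (div_lt_iff₀ (by exact_mod_cast h3)).1 h2, h3⟩
  have hLr : (0 : ℝ) < L := by exact_mod_cast hL0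
  filter_upwards [ae_tendsto_sum_block p fun u : Fin L → Fin m => wordCost T p s (List.ofFn u)]
    with i hi
  have hi1 : ∀ᶠ n : ℕ in atTop,
      (∑ b ∈ Finset.range n, wordCost T p s (curtail (fun l => i (b * L + l)) L)) / (n : ℝ) <
        ε / 2 * L := hi.eventually (gt_mem_nhds hL)
  have hdiv : Tendsto (fun k : ℕ => k / L) atTop atTop := Nat.tendsto_div_const_atTop hL0.ne'
  have hbig : ∀ᶠ k : ℕ in atTop, L * (-q) ≤ ε / 2 * k :=
    (tendsto_natCast_atTop_atTop.const_mul_atTop (half_pos hε)).eventually_ge_atTop _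
  filter_upwards [hdiv.eventually hi1, hdiv.eventually_gt_atTop 0, hbig] with k h1 h2 h3
  have h2' : (0 : ℝ) < ((k / L : ℕ) : ℝ) := by exact_mod_cast h2
  rw [div_lt_iff₀ h2'] at h1
  have h4 := wordCost_curtail_mul_add_le hN hT hT1 hp h0 hq i (k / L) L (k % L)
  rw [mul_comm (k / L) L, Nat.div_add_mod] at h4
  have h5 : ((k / L : ℕ) : ℝ) * L ≤ k := by exact_mod_cast Nat.div_mul_le_self k L
  have h6 : ((k % L : ℕ) : ℝ) * (-q) ≤ L * (-q) :=
    mul_le_mul_of_nonneg_right (by exact_mod_cast (Nat.mod_lt k hL0).le) (by linarith)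
  nlinarith

end LargeNumbers

/-! ### Borel–Cantelli for weighted partitions, and transfer to the image measure -/

/-- Points whose atom in a finite partition is small compared with a weight form a small set. -/
theorem measure_setOf_atom_lt_le {Ω ι : Type*} [MeasurableSpace Ω] (μ : Measure Ω) (g : Ω → ι)
    (S : Finset ι) (hS : ∀ ω, g ω ∈ S) (W : ι → ENNReal) :
    μ {ω | μ (g ⁻¹' {g ω}) < W (g ω)} ≤ ∑ c ∈ S, W c := by
  classical
  have hsub : {ω | μ (g ⁻¹' {g ω}) < W (g ω)} ⊆
      ⋃ c ∈ S.filter fun c => μ (g ⁻¹' {c}) < W c, g ⁻¹' {c} := by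
    intro ω hω
    simp only [Set.mem_iUnion]
    exact ⟨g ω, Finset.mem_filter.2 ⟨hS ω, hω⟩, rfl⟩
  calc _ ≤ _ := measure_mono hsub
    _ ≤ ∑ c ∈ S.filter fun c => μ (g ⁻¹' {c}) < W c, μ (g ⁻¹' {c}) :=
      measure_biUnion_finset_le _ _
    _ ≤ ∑ c ∈ S.filter fun c => μ (g ⁻¹' {c}) < W c, W c :=
      Finset.sum_le_sum fun c hc => (Finset.mem_filter.1 hc).2.le
    _ ≤ ∑ c ∈ S, W c := Finset.sum_le_sum_of_subset (Finset.filter_subset _ _)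

/-- Along a sequence of finite partitions with weights of total mass at most `1`, almost every
point eventually lies in atoms of measure at least `(k + 1)⁻²` times their weight. -/
theorem ae_eventually_le_measure_atom {Ω : Type*} [MeasurableSpace Ω] (μ : Measure Ω)
    {ι : ℕ → Type*} (g : ∀ k, Ω → ι k) (S : ∀ k, Finset (ι k)) (hS : ∀ k ω, g k ω ∈ S k)
    (W : ∀ k, ι k → ℝ) (hW0 : ∀ k c, 0 ≤ W k c) (hW : ∀ k, ∑ c ∈ S k, W k c ≤ 1) :
    ∀ᵐ ω ∂μ, ∀ᶠ k : ℕ in atTop,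
      ENNReal.ofReal (W k (g k ω) / ((k : ℝ) + 1) ^ 2) ≤ μ (g k ⁻¹' {g k ω}) := by
  have hsum : Summable fun k : ℕ => 1 / ((k : ℝ) + 1) ^ 2 := by
    have := (summable_nat_add_iff 1).2 (Real.summable_one_div_nat_pow.2 one_lt_two)
    simpa using this
  have h := ae_eventually_notMem (μ := μ) (s := fun k =>
    {ω | μ (g k ⁻¹' {g k ω}) < ENNReal.ofReal (W k (g k ω) / ((k : ℝ) + 1) ^ 2)}) (by
      refine ne_top_of_le_ne_top ?_ (ENNReal.tsum_le_tsum fun k =>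
        (measure_setOf_atom_lt_le μ (g k) (S k) (hS k)
          fun c => ENNReal.ofReal (W k c / ((k : ℝ) + 1) ^ 2)).trans
          (?_ : _ ≤ ENNReal.ofReal (1 / ((k : ℝ) + 1) ^ 2)))
      · exact hsum.tsum_ofReal_ne_top
      · rw [← ENNReal.ofReal_sum_of_nonneg fun c _ => div_nonneg (hW0 k c) (by positivity),
          ← Finset.sum_div]
        exact ENNReal.ofReal_le_ofReal (div_le_div_of_nonneg_right (hW k) (by positivity)))
  filter_upwards [h] with ω hω
  filter_upwards [hω] with k hk
  exact not_lt.1 hk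

/-- A property holds almost everywhere for the image of a finite measure under a continuous map
when it holds at the image of almost every point; no measurability is needed. -/
theorem ae_map_of_ae {X Y : Type*} [TopologicalSpace X] [CompactSpace X]
    [TopologicalSpace.PseudoMetrizableSpace X]
    [MeasurableSpace X] [BorelSpace X] [TopologicalSpace Y] [T2Space Y] [MeasurableSpace Y]
    [BorelSpace Y] {μ : Measure X} [IsFiniteMeasure μ] {f : X → Y} (hf : Continuous f)
    {P : Y → Prop} (h : ∀ᵐ x ∂μ, P (f x)) : ∀ᵐ y ∂μ.map f, P y := by
  rw [ae_iff]
  refine le_antisymm (ENNReal.le_of_forall_pos_le_add fun ε hε _ => ?_) zero_le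
  set G := toMeasurable μ {x | ¬ P (f x)}
  have hG : μ G = 0 := (measure_toMeasurable _).trans h
  -- Inner regularity replaces the conull set by a closed `K`, hence compact; its image is closed,
  -- so measurable, although the set where `P` holds need not be.
  obtain ⟨K, hKG, hK, hKε⟩ := (measurableSet_toMeasurable μ {x | ¬ P (f x)}).compl
    |>.exists_isClosed_sdiff_lt (measure_ne_top μ _) (ENNReal.coe_pos.2 hε).ne'
  have himg : IsClosed (f '' K) := (hK.isCompact.image hf).isClosed
  have hsub : {y | ¬ P y} ⊆ (f '' K)ᶜ := by
    rintro y hy ⟨x, hx, rfl⟩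
    exact hKG hx (subset_toMeasurable _ _ hy)
  calc μ.map f {y | ¬ P y} ≤ μ.map f (f '' K)ᶜ := measure_mono hsub
    _ = μ (f ⁻¹' (f '' K)ᶜ) :=
      Measure.map_apply hf.measurable himg.measurableSet.compl
    _ ≤ μ (G ∪ Gᶜ \ K) := by
      refine measure_mono fun x hx => ?_
      by_cases hxG : x ∈ G
      · exact Or.inl hxG
      · exact Or.inr ⟨hxG, fun hxK => hx ⟨x, hxK, rfl⟩⟩
    _ ≤ μ G + μ (Gᶜ \ K) := measure_union_le _ _
    _ ≤ 0 + ε := by rw [hG]; gcongr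

/-! ### Cutting ellipsoids into pieces of comparable diameter -/

/-- Partition of a ball by integer codes: the image of each class under `L` has diameter
`O(r)`, and the number of classes is `O(a₁ ⋯ a_j / r^j)`, where `a₁ ≥ a₂ ≥ ⋯` are the semiaxes
of the image of the unit ball and `r` separates the first `j` from the others. -/
theorem exists_code_of_norm_sq_eq {N : ℕ} {E F : Type*} [NormedAddCommGroup E]
    [InnerProductSpace ℝ E] [NormedAddCommGroup F] [InnerProductSpace ℝ F] (L : E →ₗ[ℝ] F)
    (e : OrthonormalBasis (Fin N) ℝ E) (a : ℕ → ℝ) (ha : ∀ i, 0 ≤ a i)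
    (hL : ∀ x, ‖L x‖ ^ 2 = ∑ i : Fin N, a i ^ 2 * inner ℝ (e i) x ^ 2) {j : ℕ} (hj : j ≤ N)
    {r R : ℝ} (hr : 0 < r) (hR : 0 ≤ R) (hlow : ∀ i < j, r ≤ a i) (hupp : ∀ i, j ≤ i → a i ≤ r) :
    ∃ (code : E → Fin j → ℤ) (S : Finset (Fin j → ℤ)),
      (∀ x, ‖x‖ ≤ R → code x ∈ S) ∧
      (S.card : ℝ) ≤ (2 * R + 2) ^ j * (∏ i ∈ Finset.range j, a i) / r ^ j ∧
      ∀ x y, ‖x‖ ≤ R → ‖y‖ ≤ R → code x = code y → ‖L x - L y‖ ≤ N * (2 * R + 1) * r := by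
  set b : Fin j → E := fun i => e (Fin.castLE hj i)
  have hin : ∀ (i : Fin N) (x : E), |inner ℝ (e i) x| ≤ ‖x‖ := fun i x => by
    simpa using abs_real_inner_le_norm (e i) x
  -- A grid of mesh `r / a i` in the first `j` coordinates, hence mesh `r` after applying `L`. The
  -- remaining coordinates need no cutting, since `L` shrinks them to size `O(r)`.
  refine ⟨fun x i => ⌊inner ℝ (b i) x * (a i / r)⌋,
    Fintype.piFinset fun i : Fin j => Finset.Icc ⌊-(R * (a i / r))⌋ ⌊R * (a i / r)⌋, ?_, ?_, ?_⟩
  · intro x hx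
    rw [Fintype.mem_piFinset]
    intro i
    have h1 := abs_le.1 ((hin (Fin.castLE hj i) x).trans hx)
    have h2 : 0 ≤ a i / r := div_nonneg (ha i) hr.le
    rw [Finset.mem_Icc]
    constructor <;> apply Int.floor_le_floor
    · rw [← neg_mul]; exact mul_le_mul_of_nonneg_right h1.1 h2
    · exact mul_le_mul_of_nonneg_right h1.2 h2
  · rw [Fintype.card_piFinset]
    push_cast
    calc _ ≤ ∏ i : Fin j, (2 * R + 2) * (a i / r) := by
          refine Finset.prod_le_prod (fun i _ => by positivity) fun i _ => ?_
          -- The number of values is at most `2R (a i / r) + 2`; this inequality absorbs the `2`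
          -- into the factor `2R + 2`.
          have h1 : 1 ≤ a i / r := by rw [one_le_div hr]; exact hlow i i.2
          have h2 : 0 ≤ R * (a i / r) := by positivity
          have h3 : ⌊-(R * (a i / r))⌋ ≤ ⌊R * (a i / r)⌋ := Int.floor_le_floor (by linarith)
          have h4 : (((⌊R * (a i / r)⌋ + 1 - ⌊-(R * (a i / r))⌋).toNat : ℤ) : ℝ) =
              ⌊R * (a i / r)⌋ + 1 - ⌊-(R * (a i / r))⌋ := by
            rw [Int.toNat_of_nonneg (by linarith)]
            push_cast
            ring
          rw [Int.card_Icc]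
          have h5 := Int.floor_le (R * (a i / r))
          have h6 := Int.lt_floor_add_one (-(R * (a i / r)))
          rw [Int.cast_natCast] at h4
          rw [h4]
          linarith
      _ = _ := by
        rw [Finset.prod_mul_distrib, Finset.prod_div_distrib, Finset.prod_range]
        simp
        ring
  · intro x y hx hy hxy
    rw [← map_sub]
    have hterm : ∀ i : Fin N, a i ^ 2 * inner ℝ (e i) (x - y) ^ 2 ≤ ((2 * R + 1) * r) ^ 2 := by
      intro i
      rw [← mul_pow, ← sq_abs]
      refine pow_le_pow_left₀ (abs_nonneg _) ?_ 2
      rw [abs_mul, abs_of_nonneg (ha i)]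
      by_cases hi : (i : ℕ) < j
      · have h1 := congrFun hxy ⟨i, hi⟩
        have h2 := Int.abs_sub_lt_one_of_floor_eq_floor h1
        have h3 : b ⟨i, hi⟩ = e i := rfl
        rw [h3, ← sub_mul, ← inner_sub_right, abs_mul, abs_of_nonneg (div_nonneg (ha _) hr.le),
          ← mul_div_assoc, div_lt_one hr] at h2
        have h4 : a i * |inner ℝ (e i) (x - y)| < r := by rw [mul_comm]; exact h2
        nlinarith
      · have h1 : |inner ℝ (e i) (x - y)| ≤ 2 * R := by
          have := (hin i (x - y)).trans (norm_sub_le x y)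
          linarith
        have := mul_le_mul (hupp i (not_lt.1 hi)) h1 (abs_nonneg _) hr.le
        nlinarith
    have h1 : ‖L (x - y)‖ ^ 2 ≤ N * ((2 * R + 1) * r) ^ 2 := by
      rw [hL]
      exact (Finset.sum_le_sum fun i _ => hterm i).trans (by simp)
    have h2 : ‖L (x - y)‖ ^ 2 ≤ (N * (2 * R + 1) * r) ^ 2 := by
      refine h1.trans ?_
      rw [show (N * (2 * R + 1) * r) ^ 2 = (N : ℝ) ^ 2 * ((2 * R + 1) * r) ^ 2 by ring]
      refine mul_le_mul_of_nonneg_right ?_ (sq_nonneg _)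
      exact_mod_cast Nat.le_self_pow two_ne_zero N
    exact le_of_sq_le_sq h2 (by positivity)

theorem exists_code_of_singularValues {N : ℕ}
    (L : EuclideanSpace ℝ (Fin N) →L[ℝ] EuclideanSpace ℝ (Fin N)) (hL : Function.Injective L)
    {j : ℕ} (hj : j < N) {R : ℝ} (hR : 0 ≤ R) :
    ∃ (code : EuclideanSpace ℝ (Fin N) → Fin j → ℤ) (S : Finset (Fin j → ℤ)),
      (∀ x, ‖x‖ ≤ R → code x ∈ S) ∧
      (S.card : ℝ) ≤ (2 * R + 2) ^ j * (∏ i ∈ Finset.range j, L.toLinearMap.singularValues i) /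
        L.toLinearMap.singularValues j ^ j ∧
      ∀ x y, ‖x‖ ≤ R → ‖y‖ ≤ R → code x = code y →
        ‖L x - L y‖ ≤ N * (2 * R + 1) * L.toLinearMap.singularValues j :=
  exists_code_of_norm_sq_eq L.toLinearMap (L.toLinearMap.rightSingularBasis (by simp)) _
    L.toLinearMap.singularValues_nonneg
    (LinearMap.norm_sq_apply_eq_sum_singularValues L.toLinearMap (by simp)) hj.le
    (singularValues_pos hL hj) hR (fun _ hi => L.toLinearMap.singularValues_antitone hi.le)
    fun _ hi => L.toLinearMap.singularValues_antitone hi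

theorem exists_code_of_radius (N : ℕ) {r R : ℝ} (hr : 0 < r) (hr1 : r ≤ 1) (hR : 0 ≤ R) :
    ∃ (code : EuclideanSpace ℝ (Fin N) → Fin N → ℤ) (S : Finset (Fin N → ℤ)),
      (∀ x, ‖x‖ ≤ R → code x ∈ S) ∧ (S.card : ℝ) ≤ (2 * R + 2) ^ N / r ^ N ∧
      ∀ x y, ‖x‖ ≤ R → ‖y‖ ≤ R → code x = code y → ‖x - y‖ ≤ N * (2 * R + 1) * r := by
  -- All `N` coordinates are cut; the semiaxes are set to `0` from index `N` on so that the upper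
  -- condition holds there.
  have h := exists_code_of_norm_sq_eq (LinearMap.id : EuclideanSpace ℝ (Fin N) →ₗ[ℝ] _)
    (EuclideanSpace.basisFun (Fin N) ℝ) (fun i => if i < N then 1 else 0)
    (fun i => by split_ifs <;> norm_num)
    (fun x => by
      rw [LinearMap.id_apply, ← (EuclideanSpace.basisFun (Fin N) ℝ).sum_sq_inner_right x]
      simp) le_rfl hr hR
    (fun i hi => by simpa [hi] using hr1) (fun i hi => by simpa [not_lt.2 hi] using hr.le)
  have h1 : ∏ i ∈ Finset.range N, (if i < N then (1 : ℝ) else 0) = 1 :=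
    Finset.prod_eq_one fun i hi => if_pos (Finset.mem_range.1 hi)
  simpa only [h1, mul_one, LinearMap.id_apply] using h

/-! ### From a sequence of radii to the local dimension -/

/-- Upper bound for the upper local dimension from mass estimates along a sequence of radii that
decreases at most geometrically. -/
theorem upperLocalDim_le_of_seq {N : ℕ} {ν : Measure (EuclideanSpace ℝ (Fin N))}
    {x : EuclideanSpace ℝ (Fin N)} {d A c : ℝ} (hd : 0 ≤ d) (hA : 0 < A) (hc : 0 < c) {r : ℕ → ℝ}
    (hr : ∀ k, 0 < r k) (hr0 : Tendsto r atTop (𝓝 0)) (hratio : ∀ k, c * r k ≤ r (k + 1))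
    (h : ∀ ε > 0, ∀ᶠ k in atTop,
      ENNReal.ofReal (r k ^ (d + ε)) ≤ ν (Metric.closedBall x (A * r k))) :
    upperLocalDim ν x ≤ (d : EReal) := by
  rw [← EReal.le_of_forall_lt_iff_le]
  intro z hz
  have hz' : d < z := by exact_mod_cast hz
  set ε := (z - d) / 2 with hε
  have hε0 : 0 < ε := by rw [hε]; linarith
  obtain ⟨k₀, hk₀⟩ := eventually_atTop.1 (h ε hε0)
  -- Keeps `ρ` below the first `k₀ + 1` radii, so that the first index `k` with `A * r k ≤ ρ`
  -- exceeds `k₀`.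
  have e1 : ∀ᶠ ρ in 𝓝[>] (0 : ℝ), ∀ k ∈ Finset.range (k₀ + 1), ρ < A * r k := by
    rw [Filter.eventually_all_finset]
    exact fun k _ => nhdsWithin_le_nhds (gt_mem_nhds (mul_pos hA (hr k)))
  -- Half of the gap `z - d` pays for the constant `c / A` lost when passing from `ρ` to `r k`.
  have e2 : ∀ᶠ ρ in 𝓝[>] (0 : ℝ), ρ ^ ε ≤ (c / A) ^ (d + ε) := by
    have h1 : Tendsto (fun ρ : ℝ => ρ ^ ε) (𝓝[>] 0) (𝓝 0) := by
      have := (Real.continuousAt_rpow_const 0 ε (Or.inr hε0.le)).tendsto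
      rw [Real.zero_rpow hε0.ne'] at this
      exact this.mono_left nhdsWithin_le_nhds
    exact h1.eventually (ge_mem_nhds (Real.rpow_pos_of_pos (div_pos hc hA) _))
  have e3 : ∀ᶠ ρ in 𝓝[>] (0 : ℝ), ρ < 1 := nhdsWithin_le_nhds (gt_mem_nhds one_pos)
  refine limsup_le_of_le (by isBoundedDefault) ?_
  filter_upwards [e1, e2, e3, self_mem_nhdsWithin] with ρ h1 h2 h3 hρ
  have hρ : 0 < ρ := hρ
  have hex : ∃ k, A * r k ≤ ρ := by
    have := hr0.const_mul A
    rw [mul_zero] at this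
    exact (this.eventually (ge_mem_nhds hρ)).exists
  obtain ⟨k, hk, hmin⟩ : ∃ k, A * r k ≤ ρ ∧ ∀ l < k, ρ < A * r l := by
    classical
    exact ⟨Nat.find hex, Nat.find_spec hex, fun l hl => not_le.1 (Nat.find_min hex hl)⟩
  have hkk : k₀ < k := by
    by_contra! hle
    exact absurd (h1 k (Finset.mem_range.2 (by omega))) (not_lt.2 hk)
  have hlow : c / A * ρ ≤ r k := by
    have h4 := hmin (k - 1) (by omega)
    have h5 := hratio (k - 1)
    rw [Nat.sub_add_cancel (by omega)] at h5
    have h6 : c / A * ρ ≤ c / A * (A * r (k - 1)) := by gcongr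
    have h7 : c / A * (A * r (k - 1)) = c * r (k - 1) := by field_simp
    linarith
  have hmass : ENNReal.ofReal (ρ ^ z) ≤ ν (Metric.closedBall x ρ) :=
    calc ENNReal.ofReal (ρ ^ z) ≤ ENNReal.ofReal (r k ^ (d + ε)) := by
          refine ENNReal.ofReal_le_ofReal ?_
          calc ρ ^ z = ρ ^ ε * ρ ^ (d + ε) := by
                rw [← Real.rpow_add hρ]; congr 1; rw [hε]; ring
            _ ≤ (c / A) ^ (d + ε) * ρ ^ (d + ε) := by gcongr
            _ = (c / A * ρ) ^ (d + ε) := by rw [Real.mul_rpow (by positivity) hρ.le]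
            _ ≤ _ := Real.rpow_le_rpow (by positivity) hlow (by linarith)
      _ ≤ _ := hk₀ k hkk.le
      _ ≤ _ := measure_mono (Metric.closedBall_subset_closedBall hk)
  have hlog : Real.log ρ < 0 := Real.log_neg hρ h3
  have h5 := ENNReal.log_monotone hmass
  rw [ENNReal.log_ofReal_of_pos (Real.rpow_pos_of_pos hρ _), Real.log_rpow hρ] at h5
  refine (EReal.div_le_div_right_of_nonpos (by exact_mod_cast hlog.le) h5).trans (le_of_eq ?_)
  rw [← EReal.coe_div, mul_div_cancel_right₀ _ hlog.ne]

theorem eventually_mul_sq_le_exp (K : ℝ) {δ : ℝ} (hδ : 0 < δ) :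
    ∀ᶠ k : ℕ in atTop, K * ((k : ℝ) + 1) ^ 2 ≤ Real.exp (δ * k) := by
  have h1 : Real.exp (-δ) < 1 := by simpa using hδ
  have h := ((tendsto_pow_const_mul_const_pow_of_abs_lt_one 2
    (by rwa [abs_of_pos (Real.exp_pos _)])).comp (tendsto_add_atTop_nat 1)).const_mul
      (K * Real.exp δ)
  rw [mul_zero] at h
  filter_upwards [h.eventually (ge_mem_nhds one_pos)] with k hk
  have h2 : Real.exp (-δ) ^ (k + 1) = Real.exp (-δ) * (Real.exp (δ * k))⁻¹ := by
    rw [← Real.exp_nat_mul, ← Real.exp_neg, ← Real.exp_add]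
    congr 1
    push_cast
    ring
  simp only [Function.comp_apply, h2] at hk
  have h3 : K * Real.exp δ * (((k + 1 : ℕ) : ℝ) ^ 2 * (Real.exp (-δ) * (Real.exp (δ * k))⁻¹)) =
      K * ((k : ℝ) + 1) ^ 2 / Real.exp (δ * k) := by
    rw [Real.exp_neg]
    push_cast
    field_simp
  rw [h3, div_le_one (Real.exp_pos _)] at hk
  exact hk

/-! ### The coding map and the two dimension bounds -/

section Coding

variable {N m : ℕ} {T : Fin m → EuclideanSpace ℝ (Fin N) →L[ℝ] EuclideanSpace ℝ (Fin N)}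
  {w : List (Fin m) → EuclideanSpace ℝ (Fin N)} {B : Set (EuclideanSpace ℝ (Fin N))}

theorem MapsIntoItself.prefix (hw : MapsIntoItself T w B) (u : List (Fin m)) :
    MapsIntoItself T (fun v => w (u ++ v)) B := by
  intro v a y hy
  simpa using hw (u ++ v) a y hy

/-- The coding maps of all translation families compatible with a compact set have a common
bound. -/
theorem exists_norm_codingMap_le (hT1 : ∀ a, ‖T a‖ < 1) {C : ℝ} (hC0 : 0 < C) (hC1 : C < 1)
    (hC : ∀ a x, ‖T a x‖ ≤ C * ‖x‖) (hne : B.Nonempty) (hB : IsCompact B) :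
    ∃ R : ℝ, 0 ≤ R ∧ ∀ w, MapsIntoItself T w B → ∀ i, ‖codingMap T w i‖ ≤ R := by
  obtain ⟨b, hb⟩ := hne
  obtain ⟨R, hR⟩ := hB.isBounded.exists_norm_le
  have hR0 : 0 ≤ R := (norm_nonneg b).trans (hR b hb)
  refine ⟨(1 - C)⁻¹ * (R + R), mul_nonneg (inv_nonneg.2 (by linarith)) (by linarith),
    fun w hw i => ?_⟩
  refine tsum_of_norm_bounded ((hasSum_geometric_of_lt_one hC0.le hC1).mul_right _) fun k => ?_
  rw [curtail_succ]
  refine (norm_wordMap_le hC0 hC _ _).trans ?_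
  rw [length_curtail]
  refine mul_le_mul_of_nonneg_left ?_ (by positivity)
  have h1 := hR _ (hw (curtail i k) (i k) b hb)
  have h2 := ((T (i k)).le_of_opNorm_le (hT1 _).le b).trans (by simpa using hR b hb)
  calc ‖w (curtail i k ++ [i k])‖
      = ‖(T (i k) b + w (curtail i k ++ [i k])) - T (i k) b‖ := by simp
    _ ≤ R + R := (norm_sub_le _ _).trans (add_le_add h1 h2)

/-- The tail after `k` letters is `T_{i|k}` applied to a coding point of the family with prefix
`i|k` removed. That family is compatible with the same `B`, so one radius bounds all tails. -/
theorem codingMap_eq_sum_add (hT1 : ∀ a, ‖T a‖ < 1) (hne : B.Nonempty) (hB : IsCompact B)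
    (hw : MapsIntoItself T w B) (i : ℕ → Fin m) (k : ℕ) :
    codingMap T w i =
      (∑ l ∈ Finset.range k, wordMap T (curtail i l) (w (curtail i (l + 1)))) +
        wordMap T (curtail i k)
          (codingMap T (fun v => w (curtail i k ++ v)) fun n => i (k + n)) := by
  have h1 := (summable_and_continuous_codingMap hT1 hne hB hw).1 i
  have h2 := (summable_and_continuous_codingMap hT1 hne hB (hw.prefix (curtail i k))).1
    fun n => i (k + n)
  rw [codingMap, ← h1.sum_add_tsum_nat_add k, codingMap, ContinuousLinearMap.map_tsum _ h2]
  congr 1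
  refine tsum_congr fun l => ?_
  rw [add_comm l k, curtail_add, wordMap_append, add_assoc, curtail_add i k (l + 1)]
  rfl

theorem curtail_eq_of_le {i i' : ℕ → Fin m} {k l : ℕ} (h : curtail i k = curtail i' k)
    (hl : l ≤ k) : curtail i l = curtail i' l := by
  unfold curtail at h ⊢
  rw [List.ofFn_inj] at h ⊢
  ext x
  have := congrFun h ⟨x, x.2.trans_le hl⟩
  simp only at this
  rw [this]

theorem codingMap_sub_codingMap (hT1 : ∀ a, ‖T a‖ < 1) (hne : B.Nonempty) (hB : IsCompact B)
    (hw : MapsIntoItself T w B) {i i' : ℕ → Fin m} {k : ℕ} (h : curtail i k = curtail i' k) :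
    codingMap T w i - codingMap T w i' =
      wordMap T (curtail i k) (codingMap T (fun v => w (curtail i k ++ v)) fun n => i (k + n)) -
        wordMap T (curtail i k)
          (codingMap T (fun v => w (curtail i k ++ v)) fun n => i' (k + n)) := by
  rw [codingMap_eq_sum_add hT1 hne hB hw i k, codingMap_eq_sum_add hT1 hne hB hw i' k, ← h,
    Finset.sum_congr rfl fun l hl => by
      rw [curtail_eq_of_le h (Finset.mem_range.1 hl).le,
        curtail_eq_of_le h (Nat.succ_le_of_lt (Finset.mem_range.1 hl))]]
  abel

theorem sum_wordProb (p : PMF (Fin m)) (k : ℕ) :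
    ∑ u : Fin k → Fin m, wordProb p (List.ofFn u) = 1 := by
  have := integral_block p (fun _ : Fin k → Fin m => (1 : ℝ)) 0
  simpa [real_wordCylinder] using this.symm

/-- Lower bounds for the projected measure of balls from partitions of the code space. -/
theorem le_projectedMeasure_closedBall {μ : Measure (ℕ → Fin m)} (hX : Continuous (codingMap T w))
    {S : Set (ℕ → Fin m)} {i : ℕ → Fin m} {ρ : ℝ}
    (hS : ∀ i' ∈ S, ‖codingMap T w i - codingMap T w i'‖ ≤ ρ) :
    μ S ≤ projectedMeasure T w μ (Metric.closedBall (codingMap T w i) ρ) := by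
  rw [projectedMeasure, Measure.map_apply hX.measurable Metric.isClosed_closedBall.measurableSet]
  refine measure_mono fun i' hi' => ?_
  rw [Set.mem_preimage, Metric.mem_closedBall, dist_comm, dist_eq_norm]
  exact hS i' hi'

/-- A ball containing the image is cut at scale `2^{-k}` into `O(2^{kN})` pieces of equal weight;
almost every point eventually lies in pieces that carry nearly this share of mass. -/
theorem ae_upperLocalDim_le_finrank (hT : ∀ a, Function.Injective (T a)) (hT1 : ∀ a, ‖T a‖ < 1)
    (hN : 1 ≤ N) (μ : Measure (ℕ → Fin m)) (hne : B.Nonempty) (hB : IsCompact B)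
    (hw : MapsIntoItself T w B) :
    ∀ᵐ i ∂μ, upperLocalDim (projectedMeasure T w μ) (codingMap T w i) ≤ ((N : ℝ) : EReal) := by
  obtain ⟨c, C, hc, hC0, hC1, hcT, hCT⟩ := exists_uniform_norm_bounds hT hT1
  obtain ⟨R, hR0, hR⟩ := exists_norm_codingMap_le hT1 hC0 hC1 hCT hne hB
  have hX := (summable_and_continuous_codingMap hT1 hne hB hw).2
  set r : ℕ → ℝ := fun k => (1 / 2) ^ k with hr
  have hrpos : ∀ k, 0 < r k := fun k => by positivity
  choose code S hcodeS hcard hdiam using fun k =>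
    exists_code_of_radius N (hrpos k) (pow_le_one₀ (by norm_num) (by norm_num) : r k ≤ 1) hR0
  set M : ℕ → ℝ := fun k => (2 * R + 2) ^ N / r k ^ N with hM
  have hMpos : ∀ k, 0 < M k := fun k => by have := hrpos k; positivity
  have key := ae_eventually_le_measure_atom μ (fun k i => code k (codingMap T w i)) S
    (fun k i => hcodeS k _ (hR w hw i)) (fun k _ => 1 / M k) (fun k _ => (div_pos one_pos (hMpos k)).le)
    (fun k => by
      rw [Finset.sum_const, nsmul_eq_mul, mul_one_div, div_le_one (hMpos k)]
      exact hcard k)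
  have hNr : (0 : ℝ) < N := by exact_mod_cast hN
  filter_upwards [key] with i hi
  refine upperLocalDim_le_of_seq (A := N * (2 * R + 1)) (c := 1 / 2) hNr.le (by positivity)
    (by norm_num) hrpos (tendsto_pow_atTop_nhds_zero_of_lt_one (by norm_num) (by norm_num))
    (fun k => by rw [hr]; simp only [pow_succ]; linarith) fun ε hε => ?_
  have hδ : 0 < ε * Real.log 2 := mul_pos hε (Real.log_pos one_lt_two)
  filter_upwards [hi, eventually_mul_sq_le_exp ((2 * R + 2) ^ N) hδ] with k h1 h2
  refine le_trans (ENNReal.ofReal_le_ofReal ?_) (h1.trans (le_projectedMeasure_closedBall hX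
    fun i' hi' => hdiam k _ _ (hR w hw i) (hR w hw i') (Set.mem_singleton_iff.1 hi').symm))
  have hexp : r k ^ ε = (Real.exp (ε * Real.log 2 * k))⁻¹ := by
    rw [← Real.exp_neg, Real.rpow_def_of_pos (hrpos k), hr]
    congr 1
    simp only [Real.log_pow, one_div, Real.log_inv]
    ring
  rw [Real.rpow_add (hrpos k), Real.rpow_natCast, hexp, hM]
  have hk : (0 : ℝ) < ((k : ℝ) + 1) ^ 2 := by positivity
  have h3 : 1 / ((2 * R + 2) ^ N / r k ^ N) / ((k : ℝ) + 1) ^ 2 =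
      r k ^ N * ((2 * R + 2) ^ N * ((k : ℝ) + 1) ^ 2)⁻¹ := by
    have := hrpos k
    field_simp
  simp only [h3]
  have := hrpos k
  gcongr

theorem ae_upperLocalDim_le_of_hasPressureOne (hT : ∀ a, Function.Injective (T a))
    (hT1 : ∀ a, ‖T a‖ < 1) (hN : 1 ≤ N) {p : PMF (Fin m)} (hp : ∀ a, 0 < p a) {d : ℝ}
    (hd : 0 ≤ d) (hdN : d < N) (hdp : HasPressureOne T (bernoulliMeasure p) d 0)
    (hne : B.Nonempty) (hB : IsCompact B) (hw : MapsIntoItself T w B) :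
    ∀ᵐ i ∂bernoulliMeasure p,
      upperLocalDim (projectedMeasure T w (bernoulliMeasure p)) (codingMap T w i) ≤
        (d : EReal) := by
  obtain ⟨c, C, hc, hC0, hC1, hcT, hCT⟩ := exists_uniform_norm_bounds hT hT1
  obtain ⟨R, hR0, hR⟩ := exists_norm_codingMap_le hT1 hC0 hC1 hCT hne hB
  have hX := (summable_and_continuous_codingMap hT1 hne hB hw).2
  set j := ⌊d⌋₊
  have hj : j < N := (Nat.floor_lt hd).2 hdN
  set r : List (Fin m) → ℝ := fun u => (wordMap T u).toLinearMap.singularValues j with hr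
  set D : List (Fin m) → ℝ :=
    fun u => ∏ l ∈ Finset.range j, (wordMap T u).toLinearMap.singularValues l
  have hrpos : ∀ u, 0 < r u := fun u => singularValues_pos (wordMap_injective hT u) hj
  have hDpos : ∀ u, 0 < D u := fun u => prod_singularValues_pos (wordMap_injective hT u) hj.le
  choose code S hcodeS hcard hdiam using fun u =>
    exists_code_of_singularValues (wordMap T u) (wordMap_injective hT u) hj hR0
  set M : List (Fin m) → ℝ := fun u => (2 * R + 2) ^ j * D u / r u ^ j with hM
  have hMpos : ∀ u, 0 < M u := fun u => by
    have := hrpos u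
    have := hDpos u
    positivity
  set tail : ℕ → (ℕ → Fin m) → EuclideanSpace ℝ (Fin N) := fun k i =>
    codingMap T (fun v => w (curtail i k ++ v)) fun n => i (k + n)
  have htailR : ∀ k i, ‖tail k i‖ ≤ R := fun k i => hR _ (hw.prefix _) _
  -- Two sequences share a class when they agree in the first `k` letters and their tails have the
  -- same code for that word. Each cylinder's mass is spread evenly over `M u` classes, so the total
  -- weight is at most `1`.
  have key := ae_eventually_le_measure_atom (bernoulliMeasure p)
    (ι := fun k => (_ : Fin k → Fin m) × (Fin j → ℤ))
    (fun k i => ⟨fun l => i l, code (curtail i k) (tail k i)⟩)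
    (fun k => Finset.univ.sigma fun u => S (List.ofFn u))
    (fun k i => Finset.mem_sigma.2 ⟨Finset.mem_univ _, hcodeS _ _ (htailR k i)⟩)
    (fun k z => wordProb p (List.ofFn z.1) / M (List.ofFn z.1))
    (fun k z => (div_pos (wordProb_pos hp _) (hMpos _)).le)
    (fun k => by
      rw [Finset.sum_sigma, ← sum_wordProb p k]
      refine Finset.sum_le_sum fun u _ => ?_
      dsimp only
      rw [Finset.sum_const, nsmul_eq_mul, ← mul_div_assoc, div_le_iff₀ (hMpos _), mul_comm]
      exact mul_le_mul_of_nonneg_left (hcard _) (wordProb_pos hp _).le)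
  -- Rates `1/(n+1)` rather than all `ε`, so that a single null set serves every `ε`.
  have hcost : ∀ᵐ i ∂bernoulliMeasure p, ∀ n : ℕ, ∀ᶠ k : ℕ in atTop,
      wordCost T p d (curtail i k) ≤ 1 / ((n : ℝ) + 1) * k :=
    ae_all_iff.2 fun n =>
      ae_eventually_wordCost_le hN hT hT1 hp hd hdp (Nat.one_div_pos_of_nat (n := n))
  have hNr : (0 : ℝ) < N := by exact_mod_cast hN
  have hrC : ∀ (i : ℕ → Fin m) k, r (curtail i k) ≤ C ^ k := fun i k => by
    simpa [length_curtail] using singularValues_wordMap_le hC0 hCT (curtail i k) hj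
  filter_upwards [key, hcost] with i hi hcosti
  refine upperLocalDim_le_of_seq (r := fun k => r (curtail i k)) (A := N * (2 * R + 1)) (c := c)
    hd (by positivity) hc (fun k => hrpos _)
    (squeeze_zero (fun k => (hrpos _).le) (hrC i)
      (tendsto_pow_atTop_nhds_zero_of_lt_one hC0.le hC1))
    (fun k => by
      simp only [hr]
      rw [curtail_succ, wordMap_append]
      exact mul_singularValues_le_mul hc (by simpa [wordMap] using hcT (i k)) hj) fun ε hε => ?_
  -- Since `r ≤ C^k`, `r^ε ≤ e^{-2δk}`: one factor `e^{-δk}` pays for the cost, the other for the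
  -- constant and `(k+1)²`.
  set δ := ε * (-Real.log C) / 2 with hδ
  have hδ0 : 0 < δ := half_pos (mul_pos hε (neg_pos.2 (Real.log_neg hC0 hC1)))
  obtain ⟨n, hn⟩ := exists_nat_one_div_lt hδ0
  filter_upwards [hi, hcosti n, eventually_mul_sq_le_exp ((2 * R + 2) ^ j) hδ0] with k h1 h2 h3
  set u := curtail i k with hu
  refine le_trans (ENNReal.ofReal_le_ofReal ?_) (h1.trans (le_projectedMeasure_closedBall hX
    fun i' hi' => ?_))
  · rw [show List.ofFn (fun l : Fin k => i l) = u from rfl]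
    -- The choice `j = ⌊d⌋` matters here: it turns the class weight into `r^d` times the exponential
    -- of minus the cost, up to a constant.
    have hφ : singularValueFunction d (wordMap T u) * r u ^ j = D u * r u ^ d := by
      rw [singularValueFunction, if_pos hdN, mul_assoc, ← Real.rpow_natCast (r u) j,
        ← Real.rpow_add (hrpos u)]
      congr 2
      ring
    have hφpos := singularValueFunction_pos (wordMap_injective hT u) hd
    have hp' := wordProb_pos hp u
    have hexp : Real.exp (wordCost T p d u) =
        singularValueFunction d (wordMap T u) / wordProb p u := by
      rw [wordCost, Real.exp_sub, Real.exp_log hφpos, Real.exp_log hp']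
    have hr' := hrpos u
    have hD' := hDpos u
    have hK : 0 < (2 * R + 2) ^ j := by positivity
    have hk : (0 : ℝ) < ((k : ℝ) + 1) ^ 2 := by positivity
    have h4 : wordProb p u / M u / ((k : ℝ) + 1) ^ 2 =
        r u ^ d * (Real.exp (wordCost T p d u) * ((2 * R + 2) ^ j * ((k : ℝ) + 1) ^ 2))⁻¹ := by
      rw [hexp, hM, eq_comm]
      simp only
      rw [show r u ^ d = singularValueFunction d (wordMap T u) * r u ^ j / D u by
        rw [hφ, mul_div_cancel_left₀ _ hD'.ne']]
      field_simp
    rw [h4, Real.rpow_add hr']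
    refine mul_le_mul_of_nonneg_left ?_ (Real.rpow_pos_of_pos hr' _).le
    have h5 : wordCost T p d u ≤ δ * k :=
      h2.trans (mul_le_mul_of_nonneg_right hn.le (Nat.cast_nonneg k))
    calc r u ^ ε ≤ (C ^ k) ^ ε := Real.rpow_le_rpow hr'.le (hrC i k) hε.le
      _ = (Real.exp (δ * k) * Real.exp (δ * k))⁻¹ := by
        rw [Real.rpow_def_of_pos (by positivity), Real.log_pow, ← Real.exp_add, ← Real.exp_neg, hδ]
        congr 1
        ring
      _ ≤ _ := by
        refine inv_anti₀ (by positivity) ?_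
        exact mul_le_mul (Real.exp_le_exp.2 h5) h3 (by positivity) (Real.exp_pos _).le
  · have h4 : (fun l : Fin k => i' l) = fun l : Fin k => i l := congrArg Sigma.fst hi'
    have h5 : curtail i k = curtail i' k := congrArg List.ofFn h4.symm
    have h6 : code (curtail i' k) (tail k i') = code (curtail i k) (tail k i) := by
      have := congrArg Sigma.snd (Set.mem_singleton_iff.1 hi')
      exact this
    rw [codingMap_sub_codingMap hT1 hne hB hw h5]
    have h7 : tail k i' = codingMap T (fun v => w (curtail i k ++ v)) fun n => i' (k + n) := by
      rw [h5]
    rw [← h5, h7] at h6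
    exact hdiam u _ _ (htailR k i) (h7 ▸ htailR k i') h6.symm

end Coding

end AlmostSelfAffine

end

theorem proposition5p2 {N m : ℕ} (hN : 1 ≤ N) (hm : 2 ≤ m)
    (T : Fin m → EuclideanSpace ℝ (Fin N) →L[ℝ] EuclideanSpace ℝ (Fin N))
    (hT_inj : ∀ a, Function.Injective (T a)) (hT_contr : ∀ a, ‖T a‖ < 1)
    (p : PMF (Fin m)) (hp : ∀ a, 0 < p a) :
    ∃ d₁ : ℝ,
      0 < d₁ ∧
      AlmostSelfAffine.HasPressureOne T (AlmostSelfAffine.bernoulliMeasure p) d₁ 0 ∧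
      (∀ s : ℝ, 0 ≤ s →
        AlmostSelfAffine.HasPressureOne T (AlmostSelfAffine.bernoulliMeasure p) s 0 → s = d₁) ∧
      ∀ w : List (Fin m) → EuclideanSpace ℝ (Fin N),
        (∃ B : Set (EuclideanSpace ℝ (Fin N)), B.Nonempty ∧ IsCompact B ∧
          AlmostSelfAffine.MapsIntoItself T w B) →
        ∀ᵐ x ∂(AlmostSelfAffine.projectedMeasure T w (AlmostSelfAffine.bernoulliMeasure p)),
          AlmostSelfAffine.upperLocalDim
              (AlmostSelfAffine.projectedMeasure T w (AlmostSelfAffine.bernoulliMeasure p)) x ≤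
            ((min d₁ (N : ℝ) : ℝ) : EReal) := by
  obtain ⟨d, hd0, hd, huniq⟩ :=
    AlmostSelfAffine.exists_unique_hasPressureOne_zero hN hm hT_inj hT_contr hp
  refine ⟨d, hd0, hd, huniq, ?_⟩
  rintro w ⟨B, hne, hB, hw⟩
  refine AlmostSelfAffine.ae_map_of_ae
    (AlmostSelfAffine.summable_and_continuous_codingMap hT_contr hne hB hw).2 ?_
  -- For `d ≥ N` the pressure plays no role: the ambient dimension gives the bound.
  rcases lt_or_ge d N with h | h
  · rw [min_eq_left h.le]
    exact AlmostSelfAffine.ae_upperLocalDim_le_of_hasPressureOne hT_inj hT_contr hN hp hd0.le h hd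
      hne hB hw
  · rw [min_eq_right h]
    exact AlmostSelfAffine.ae_upperLocalDim_le_finrank hT_inj hT_contr hN _ hne hB hw
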